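/- Let $(\Omega,\mu)$ be a probability space. A family $\{\phi_j\}_{j\in J}$ of complex-valued functions on $\Omega$ is an orthonormal system (OS) if it is orthonormal in $L^2(\mu)$. It is uniformly bounded by $M$ if $\|\phi_j\|_{L^\infty}\le M$ for all $j$, and it satisfies the $\psi_2(C)$ condition if $$\Big\|\sum_{j} a_j\phi_j\Big\|_{\psi_2}\le C\Big(\sum_j|a_j|^2\Big)^{1/2}$$ for all finitely supported families $(a_j)$ of complex numbers, where $\|f\|_{\psi_2}=\inf\{t>0:\int (e^{|f|^2/t^2}-1)\,d\mu\le 1\}$ is the Orlicz norm associated with $\psi_2(x)=e^{|x|^2}-1$. A uniformly bounded OS $\{\Phi_j\}_{j\in J}$ on a probability space is Sidon with constant $\gamma>0$ if $$\Big\|\sum_j a_j\Phi_j\Big\|_{L^\infty}\ge\gamma\sum_j|a_j|$$ for all families $(a_j)$ of complex numbers with $\sum_j|a_j|<\infty$; here $\|\cdot\|_{L^\infty}$ is the essential supremum, so the same bound holds for the pointwise supremum. **Theorem.** For all real $M$ and $C$ there is a constant $\gamma=\gamma(M,C)>0$ such that the following holds. Let $\{\phi_j\}_{j\in J}$ be an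 OS of complex-valued functions on any probability space $(\Omega,\mu)$ that is uniformly bounded by $M$ and satisfies the $\psi_2(C)$ condition. Then the five-fold tensor system $$\Phi_j(x_1,\dots,x_5)=\phi_j(x_1)\phi_j(x_2)\phi_j(x_3)\phi_j(x_4)\phi_j(x_5)$$ on the product space $(\Omega^5,\mu^{\otimes 5})$ is an OS, is uniformly bounded by $M^5$, and is Sidon with constant $\gamma$. -/

import Mathlib

open MeasureTheory
open scoped ENNReal

universe u v

noncomputable section

/-- The Orlicz (Luxemburg) norm of `f` for `ψ₂(x) = exp(|x|²) - 1`, i.e. the infimum of the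
`t > 0` with `∫ ψ₂(|f| / t) dμ ≤ 1`; it is `∞` if there is no such `t`. -/
def psiTwoNorm {Ω : Type*} [MeasurableSpace Ω] (μ : Measure Ω) (f : Ω → ℂ) : ℝ≥0∞ :=
  ⨅ (t : ℝ) (_ : 0 < t)
    (_ : ∫⁻ ω, ENNReal.ofReal (Real.exp ((‖f ω‖ / t) ^ 2) - 1) ∂μ ≤ 1), ENNReal.ofReal t

/-- `φ` is an orthonormal system in `L²(μ; ℂ)`. -/
def IsOrthonormalSystem {Ω ι : Type*} [MeasurableSpace Ω] (μ : Measure Ω) (φ : ι → Ω → ℂ) : Prop :=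
  ∃ h : ∀ j, MemLp (φ j) 2 μ, Orthonormal ℂ (fun j => (h j).toLp (φ j))

/-- `φ` is uniformly bounded by `M`: `‖φ_j‖_{L^∞} ≤ M` for all `j`. -/
def UniformlyBoundedBy {Ω ι : Type*} [MeasurableSpace Ω] (μ : Measure Ω) (φ : ι → Ω → ℂ)
    (M : ℝ) : Prop :=
  ∀ j, eLpNorm (φ j) ∞ μ ≤ ENNReal.ofReal M

/-- The `ψ₂(C)` condition: `‖∑ a_j φ_j‖_{ψ₂} ≤ C (∑ |a_j|²)^{1/2}` for all finite sums. -/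
def PsiTwoCondition {Ω ι : Type*} [MeasurableSpace Ω] (μ : Measure Ω) (φ : ι → Ω → ℂ)
    (C : ℝ) : Prop :=
  ∀ (s : Finset ι) (a : ι → ℂ),
    psiTwoNorm μ (fun ω => ∑ j ∈ s, a j * φ j ω) ≤ ENNReal.ofReal (C * √(∑ j ∈ s, ‖a j‖ ^ 2))

/-- The Sidon inequality with constant `γ`: `‖∑ a_j φ_j‖_{L^∞} ≥ γ ∑ |a_j|` for all absolutely
summable (in particular, all finitely supported) families of complex coefficients.
The left side is the essential supremum, which is at most the pointwise supremum
(see `SidonWith.le_iSup`). -/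
def SidonWith {Ω ι : Type*} [MeasurableSpace Ω] (μ : Measure Ω) (φ : ι → Ω → ℂ)
    (γ : ℝ) : Prop :=
  ∀ a : ι → ℂ, Summable (fun j => ‖a j‖) →
    ENNReal.ofReal (γ * ∑' j, ‖a j‖) ≤ eLpNorm (fun ω => ∑' j, a j * φ j ω) ∞ μ

theorem SidonWith.le_iSup {Ω ι : Type*} [MeasurableSpace Ω] {μ : Measure Ω} {φ : ι → Ω → ℂ}
    {γ : ℝ} (h : SidonWith μ φ γ) (a : ι → ℂ) (ha : Summable (fun j => ‖a j‖)) :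
    ENNReal.ofReal (γ * ∑' j, ‖a j‖) ≤ ⨆ ω, ‖∑' j, a j * φ j ω‖ₑ := by
  refine (h a ha).trans ?_
  rw [eLpNorm_exponent_top]
  exact essSup_le_of_ae_le _ (Filter.Eventually.of_forall fun ω =>
    _root_.le_iSup (fun ω => ‖∑' j, a j * φ j ω‖ₑ) ω)

/-- The `k`-fold tensor system `φ_j ⊗ ⋯ ⊗ φ_j` on the `k`-fold product space. -/
def tensorSystem {Ω ι : Type*} (k : ℕ) (φ : ι → Ω → ℂ) : ι → (Fin k → Ω) → ℂ :=
  fun j x => ∏ s, φ j (x s)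

end

/-! By duality it suffices, for finitely many coefficients `a` listed with decreasing modulus, to
find `F` on the product with L¹ norm at most 2 for which `|∑ a_k ∫ F Φ_k|` dominates a multiple of
`∑ |a_k|`. Interpolation is only needed on average with respect to the weights `|a_k|`, not at every
`k`.

`F` is built from random densities `ν_ε`, indexed by sign vectors, of L¹ norm at most 1, whose
correlations `b_k = 𝔼 ε_k ∫ ν_ε φ_k` have weighted average modulus at least `c`
(`exists_random_density`). Average over four independent sign vectors `p_i` the product of the
`ν_{p_i}(x_i)` and a Riesz kernel in the signs `∏ p_i`, with coefficients `δ s_j conj (φ_j(x_5))`.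
By Walsh expansion `∫ F Φ_k = ∑_S c_S b_S ^ 4`. The set `{k}` gives `(δ/2) s_k b_k ^ 4`, the other
singletons vanish by orthogonality, the empty set is removed by hand, and Bessel makes the sets of
size at least 2 contribute `O(δ²)`; a small `δ` wins (`exists_interpolating_density`).

The main densities are normalized indicators of sets where `∑ ε_j u_j` is large, with `u_j = Re (ζ
φ_j)`. On a block of `n` indices, tilt by `exp (l ∑ ε_j u_j)` and add indices one by one: the mean
free energy grows by the Gibbs variance of the new function. The subgaussian tails force any measure
of density at most `e^{βn}` to have a small vector of means, so variances stay comparable to second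
moments and the free energy is of order `n` (`freeEnergy_ge`). This yields sets of measure at least
`e^{-O(n)}` on which the signed sum is of order `n` on average over `ε` (`exists_block_selection`).
Decreasing weights are controlled by blocks of geometric size, and the mass lost on one block is
affordable on the next, much larger one (`exists_multiblock_selection`). -/

/-! ### Averages over the sign cube and Walsh functions -/

section SignCube

open scoped BigOperators

variable {ι : Type*} [Fintype ι] [DecidableEq ι]

/-- Change the sign of the `j`-th coordinate. -/
def flipSign (j : ι) (ε : ι → ℤˣ) : ι → ℤˣ := Function.update ε j (-ε j)

/-- The value of a sign as a real number. -/
def sgn (ε : ι → ℤˣ) (j : ι) : ℝ := ((ε j : ℤ) : ℝ)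

omit [Fintype ι] [DecidableEq ι] in
theorem sgn_mul_self (ε : ι → ℤˣ) (j : ι) : sgn ε j * sgn ε j = 1 := by
  rcases Int.units_eq_one_or (ε j) with h | h <;> simp [sgn, h]

omit [Fintype ι] [DecidableEq ι] in
theorem abs_sgn (ε : ι → ℤˣ) (j : ι) : |sgn ε j| = 1 := by
  rcases Int.units_eq_one_or (ε j) with h | h <;> simp [sgn, h]

omit [Fintype ι] in
theorem sgn_flipSign_self (ε : ι → ℤˣ) (j : ι) : sgn (flipSign j ε) j = -sgn ε j := by
  simp [sgn, flipSign]

omit [Fintype ι] in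
theorem sgn_flipSign_of_ne (ε : ι → ℤˣ) {i j : ι} (h : i ≠ j) :
    sgn (flipSign j ε) i = sgn ε i := by
  simp [sgn, flipSign, h]

omit [Fintype ι] in
theorem flipSign_flipSign (j : ι) (ε : ι → ℤˣ) : flipSign j (flipSign j ε) = ε := by
  ext i
  by_cases h : i = j
  · subst h; simp [flipSign]
  · simp [flipSign, h]

theorem expect_flipSign {E : Type*} [AddCommMonoid E] [Module ℚ≥0 E] (j : ι)
    (f : (ι → ℤˣ) → E) : 𝔼 ε, f (flipSign j ε) = 𝔼 ε, f ε :=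
  Fintype.expect_equiv
    ⟨flipSign j, flipSign j, flipSign_flipSign j, flipSign_flipSign j⟩ _ _ fun _ => rfl

theorem expect_eq_zero_of_flipSign (j : ι) (f : (ι → ℤˣ) → ℝ)
    (h : ∀ ε, f (flipSign j ε) = -f ε) : 𝔼 ε, f ε = 0 := by
  have h1 := expect_flipSign j f
  simp only [h, Finset.expect_neg_distrib] at h1
  linarith

/-- Resampling the coordinates outside `A` does not change an average over the cube. -/
theorem expect_expect_piecewise (A : Finset ι) (f : (ι → ℤˣ) → ℝ) :
    𝔼 ε, 𝔼 ε', f (A.piecewise ε ε') = 𝔼 ε, f ε := by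
  have h1 : 𝔼 p : (ι → ℤˣ) × (ι → ℤˣ), f (A.piecewise p.1 p.2) =
      𝔼 p : (ι → ℤˣ) × (ι → ℤˣ), f p.1 := by
    refine Fintype.expect_equiv
      ⟨fun p => (A.piecewise p.1 p.2, A.piecewise p.2 p.1),
        fun p => (A.piecewise p.1 p.2, A.piecewise p.2 p.1), ?_, ?_⟩ _ _ fun _ => rfl <;>
    · rintro ⟨p, q⟩
      ext i <;> by_cases h : i ∈ A <;> simp [h]
  have h2 := Finset.expect_product' (Finset.univ : Finset (ι → ℤˣ)) Finset.univ
    (fun ε ε' => f (A.piecewise ε ε'))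
  have h3 := Finset.expect_product' (Finset.univ : Finset (ι → ℤˣ)) Finset.univ
    (fun ε (_ : ι → ℤˣ) => f ε)
  rw [Finset.univ_product_univ] at h2 h3
  rw [← h2, h1, h3]
  simp

/-- The Walsh function attached to a set of coordinates. -/
def walsh (S : Finset ι) (ε : ι → ℤˣ) : ℝ := ∏ j ∈ S, sgn ε j

omit [Fintype ι] [DecidableEq ι] in
theorem walsh_mul_self (S : Finset ι) (ε : ι → ℤˣ) : walsh S ε * walsh S ε = 1 := by
  simp [walsh, ← Finset.prod_mul_distrib, sgn_mul_self]

omit [Fintype ι] in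
theorem walsh_flipSign (S : Finset ι) (j : ι) (ε : ι → ℤˣ) :
    walsh S (flipSign j ε) = (if j ∈ S then -1 else 1) * walsh S ε := by
  unfold walsh
  split_ifs with h
  · rw [← Finset.mul_prod_erase _ _ h, ← Finset.mul_prod_erase _ _ h, sgn_flipSign_self,
      Finset.prod_congr rfl fun i hi => sgn_flipSign_of_ne ε (Finset.ne_of_mem_erase hi)]
    ring
  · rw [one_mul]
    exact Finset.prod_congr rfl fun i hi =>
      sgn_flipSign_of_ne ε fun hij => h (hij ▸ hi)

theorem expect_walsh_mul_walsh (S T : Finset ι) :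
    𝔼 ε, walsh S ε * walsh T ε = if S = T then 1 else 0 := by
  split_ifs with h
  · subst h
    simp [walsh_mul_self]
  · obtain ⟨j, hj⟩ : ∃ j, ¬(j ∈ S ↔ j ∈ T) := by
      by_contra! hc
      exact h (Finset.ext hc)
    refine expect_eq_zero_of_flipSign j _ fun ε => ?_
    rw [walsh_flipSign, walsh_flipSign]
    by_cases h1 : j ∈ S <;> by_cases h2 : j ∈ T <;> simp_all

/-- Bessel's inequality for the Walsh functions. -/
theorem sum_sq_expect_mul_walsh_le (h : (ι → ℤˣ) → ℝ) :
    ∑ S : Finset ι, (𝔼 ε, h ε * walsh S ε) ^ 2 ≤ 𝔼 ε, h ε ^ 2 := by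
  set b : Finset ι → ℝ := fun S => 𝔼 ε, h ε * walsh S ε with hb
  have h0 : 0 ≤ 𝔼 ε, (h ε - ∑ S, b S * walsh S ε) ^ 2 :=
    Finset.expect_nonneg fun _ _ => sq_nonneg _
  have h1 : 𝔼 ε, h ε * ∑ S, b S * walsh S ε = ∑ S, b S ^ 2 := by
    simp_rw [Finset.mul_sum]
    rw [Finset.expect_sum_comm]
    refine Finset.sum_congr rfl fun S _ => ?_
    rw [sq]
    nth_rw 3 [hb]
    simp only
    rw [Finset.mul_expect]
    exact Finset.expect_congr rfl fun _ _ => by ring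
  have h2 : 𝔼 ε, (∑ S, b S * walsh S ε) ^ 2 = ∑ S, b S ^ 2 := by
    have : ∀ ε, (∑ S, b S * walsh S ε) ^ 2 =
        ∑ S, ∑ T, b S * b T * (walsh S ε * walsh T ε) := fun ε => by
      rw [sq, Finset.sum_mul_sum]
      exact Finset.sum_congr rfl fun _ _ => Finset.sum_congr rfl fun _ _ => by ring
    simp_rw [this]
    rw [Finset.expect_sum_comm]
    refine Finset.sum_congr rfl fun S _ => ?_
    rw [Finset.expect_sum_comm]
    simp_rw [← Finset.mul_expect, expect_walsh_mul_walsh]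
    simp [sq]
  have h3 : ∀ ε, (h ε - ∑ S, b S * walsh S ε) ^ 2 =
      h ε ^ 2 - 2 * (h ε * ∑ S, b S * walsh S ε) + (∑ S, b S * walsh S ε) ^ 2 := fun ε => by ring
  simp_rw [h3] at h0
  rw [Finset.expect_add_distrib, Finset.expect_sub_distrib, ← Finset.mul_expect, h1, h2] at h0
  linarith

/-- Bessel's inequality for the Walsh functions, for complex-valued functions. -/
theorem sum_norm_sq_expect_mul_walsh_le (h : (ι → ℤˣ) → ℂ) :
    ∑ S : Finset ι, ‖𝔼 ε, h ε * (walsh S ε : ℂ)‖ ^ 2 ≤ 𝔼 ε, ‖h ε‖ ^ 2 := by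
  have hre : ∀ S : Finset ι, (𝔼 ε, h ε * (walsh S ε : ℂ)).re = 𝔼 ε, (h ε).re * walsh S ε := by
    intro S
    simp
  have him : ∀ S : Finset ι, (𝔼 ε, h ε * (walsh S ε : ℂ)).im = 𝔼 ε, (h ε).im * walsh S ε := by
    intro S
    simp
  have hn : ∀ z : ℂ, ‖z‖ ^ 2 = z.re ^ 2 + z.im ^ 2 := fun z => by
    rw [Complex.sq_norm, Complex.normSq_apply]; ring
  simp_rw [hn, hre, him]
  rw [Finset.sum_add_distrib, Finset.expect_add_distrib]
  exact add_le_add (sum_sq_expect_mul_walsh_le _) (sum_sq_expect_mul_walsh_le _)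

end SignCube

/-! ### Log-partition functions and tilted measures -/

section Gibbs

open ProbabilityTheory Real

variable {Ω : Type*} [MeasurableSpace Ω]

theorem integrable_of_abs_le {P : Measure Ω} [IsFiniteMeasure P] {v : Ω → ℝ} {b : ℝ}
    (hv : Measurable v) (hb : ∀ x, |v x| ≤ b) : Integrable v P :=
  Integrable.of_bound hv.aestronglyMeasurable b (Filter.Eventually.of_forall hb)

theorem integrable_exp_of_abs_le {P : Measure Ω} [IsFiniteMeasure P] {v : Ω → ℝ} {b : ℝ}
    (hv : Measurable v) (hb : ∀ x, |v x| ≤ b) : Integrable (fun x => exp (v x)) P :=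
  integrable_of_abs_le (b := exp b) (measurable_exp.comp hv) fun x => by
    rw [abs_of_pos (exp_pos _)]
    exact exp_le_exp.2 ((le_abs_self _).trans (hb x))

theorem abs_integral_le_of_abs_le {P : Measure Ω} [IsProbabilityMeasure P] {v : Ω → ℝ} {b : ℝ}
    (hb : ∀ x, |v x| ≤ b) : |∫ x, v x ∂P| ≤ b := by
  simpa using norm_integral_le_of_norm_le_const (μ := P) (f := v) (C := b)
    (Filter.Eventually.of_forall hb)

theorem one_add_add_sq_div_four_le_exp {z : ℝ} (hz : |z| ≤ 1) : 1 + z + z ^ 2 / 4 ≤ exp z := by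
  -- The cubic remainder is at most `(2/9)|z|³`, and `1/2 - 2/9 > 1/4`.
  have h := Real.exp_bound hz (n := 3) (by norm_num)
  simp only [Finset.sum_range_succ, Finset.sum_range_zero, Nat.factorial] at h
  norm_num at h
  have h1 : |z| ^ 3 ≤ z ^ 2 := by
    rw [pow_succ, sq_abs]
    exact mul_le_of_le_one_right (sq_nonneg z) hz
  have h2 := (abs_le.1 h).1
  nlinarith [sq_nonneg z]

/-- After centring, the linear term integrates to zero and the quadratic one gives `1 + x` with `x =
t² Var / 4 ≤ 1`; then `log (1 + x) ≥ x / (1 + x) ≥ x / 2`. -/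
theorem le_log_integral_exp {G : Measure Ω} [IsProbabilityMeasure G] {v : Ω → ℝ} {b t : ℝ}
    (hv : Measurable v) (hb : ∀ x, |v x| ≤ b) (ht : |t| * (2 * b) ≤ 1) :
    t * ∫ x, v x ∂G + t ^ 2 / 8 * Var[v; G] ≤ log (∫ x, exp (t * v x) ∂G) := by
  set m := ∫ x, v x ∂G with hm
  have hmb : |m| ≤ b := abs_integral_le_of_abs_le hb
  have hvi : Integrable v G := integrable_of_abs_le hv hb
  have hz : ∀ x, |t * (v x - m)| ≤ 1 := fun x => by
    rw [abs_mul]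
    refine le_trans (mul_le_mul_of_nonneg_left ?_ (abs_nonneg t)) ht
    calc |v x - m| ≤ |v x| + |m| := abs_sub _ _
      _ ≤ 2 * b := by linarith [hb x]
  have hzm : Measurable fun x => t * (v x - m) := by fun_prop
  have hsqi : Integrable (fun x => (v x - m) ^ 2) G := by
    refine integrable_of_abs_le (b := (2 * b) ^ 2) (by fun_prop) fun x => ?_
    rw [abs_of_nonneg (sq_nonneg _), ← sq_abs]
    refine pow_le_pow_left₀ (abs_nonneg _) ?_ 2
    calc |v x - m| ≤ |v x| + |m| := abs_sub _ _
      _ ≤ 2 * b := by linarith [hb x]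
  have hvar : Var[v; G] = ∫ x, (v x - m) ^ 2 ∂G := variance_eq_integral hv.aemeasurable
  have hvar1 : t ^ 2 * Var[v; G] ≤ 1 := by
    rw [hvar, ← integral_const_mul]
    refine (le_abs_self _).trans (abs_integral_le_of_abs_le fun x => ?_)
    rw [← mul_pow, abs_of_nonneg (sq_nonneg _), ← sq_abs]
    exact pow_le_one₀ (abs_nonneg _) (hz x)
  have hvar0 : 0 ≤ t ^ 2 * Var[v; G] := mul_nonneg (sq_nonneg _) (variance_nonneg _ _)
  have h1 : 1 + t ^ 2 * Var[v; G] / 4 ≤ ∫ x, exp (t * (v x - m)) ∂G := by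
    have : ∫ x, (1 + t * (v x - m) + (t * (v x - m)) ^ 2 / 4) ∂G =
        1 + t ^ 2 * Var[v; G] / 4 := by
      have e : ∀ x, 1 + t * (v x - m) + (t * (v x - m)) ^ 2 / 4 =
        (1 + t * (v x - m)) + t ^ 2 / 4 * (v x - m) ^ 2 := fun x => by ring
      simp_rw [e]
      rw [integral_add (by fun_prop) (hsqi.const_mul _), integral_add (by fun_prop) (by fun_prop),
        integral_const_mul, integral_const_mul, integral_sub hvi (by fun_prop), hvar]
      simp [← hm]
      ring
    rw [← this]
    refine integral_mono ?_ (integrable_exp_of_abs_le hzm hz) fun x =>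
      one_add_add_sq_div_four_le_exp (hz x)
    refine Integrable.add (by fun_prop) (Integrable.div_const ?_ _)
    simp_rw [mul_pow]
    exact hsqi.const_mul _
  have h2 : ∫ x, exp (t * v x) ∂G = exp (t * m) * ∫ x, exp (t * (v x - m)) ∂G := by
    rw [← integral_const_mul]
    refine integral_congr_ae (Filter.Eventually.of_forall fun x => ?_)
    simp only [← exp_add]
    ring_nf
  have h3 : t ^ 2 / 8 * Var[v; G] ≤ log (∫ x, exp (t * (v x - m)) ∂G) := by
    refine le_trans ?_ (log_le_log (by linarith) h1)
    have := one_sub_inv_le_log_of_pos (x := 1 + t ^ 2 * Var[v; G] / 4) (by linarith)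
    refine le_trans ?_ this
    rw [le_sub_comm, inv_le_iff_one_le_mul₀ (by linarith)]
    nlinarith
  rw [h2, log_mul (exp_pos _).ne' (by linarith), log_exp]
  linarith

/-- Chain rule for log-partition functions: adding `g` to the exponent contributes its log-Laplace
transform under the Gibbs measure of `f`. -/
theorem log_integral_exp_add {P : Measure Ω} [IsProbabilityMeasure P] {f g : Ω → ℝ} {a b : ℝ}
    (hf : Measurable f) (hfb : ∀ x, |f x| ≤ a) (hg : Measurable g) (hgb : ∀ x, |g x| ≤ b) :
    log (∫ x, exp (f x + g x) ∂P) =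
      log (∫ x, exp (f x) ∂P) + log (∫ x, exp (g x) ∂(P.tilted f)) := by
  have h1 : 0 < ∫ x, exp (f x) ∂P := integral_exp_pos (integrable_exp_of_abs_le hf hfb)
  have h2 : 0 < ∫ x, exp ((f + g) x) ∂P :=
    integral_exp_pos (integrable_exp_of_abs_le (v := f + g) (b := a + b) (hf.add hg) fun x =>
      (abs_add_le _ _).trans (add_le_add (hfb x) (hgb x)))
  rw [integral_exp_tilted, log_div h2.ne' h1.ne']
  simp

/-- The tilting density has numerator at most `e^b` and normalization at least `e^{-b}`. -/
theorem tilted_real_le {P : Measure Ω} [IsProbabilityMeasure P] {f : Ω → ℝ} {b : ℝ}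
    (hf : Measurable f) (hb : ∀ x, |f x| ≤ b) {B : Set Ω} (hB : MeasurableSet B) :
    (P.tilted f).real B ≤ exp (2 * b) * P.real B := by
  have hi := integrable_exp_of_abs_le (P := P) hf hb
  have hZ : exp (-b) ≤ ∫ x, exp (f x) ∂P := by
    have : ∫ _, exp (-b) ∂P ≤ ∫ x, exp (f x) ∂P :=
      integral_mono (integrable_const _) hi fun x => exp_le_exp.2 (abs_le.1 (hb x)).1
    simpa using this
  have hZ0 : 0 < ∫ x, exp (f x) ∂P := (exp_pos _).trans_le hZ
  rw [measureReal_def, tilted_apply_eq_ofReal_integral' _ hB, ENNReal.toReal_ofReal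
    (integral_nonneg fun x => div_nonneg (exp_pos _).le hZ0.le)]
  calc ∫ x in B, exp (f x) / ∫ x, exp (f x) ∂P ∂P ≤ ∫ _ in B, exp (2 * b) ∂P := by
        refine integral_mono (hi.integrableOn.div_const _) (integrable_const _) fun x => ?_
        simp only
        rw [div_le_iff₀ hZ0]
        calc exp (f x) ≤ exp b := exp_le_exp.2 (abs_le.1 (hb x)).2
          _ = exp (2 * b) * exp (-b) := by rw [← exp_add]; ring_nf
          _ ≤ _ := mul_le_mul_of_nonneg_left hZ (exp_pos _).le
    _ = exp (2 * b) * P.real B := by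
        simp [mul_comm]

end Gibbs

/-! ### Subgaussian tails and small mean vectors -/

section Block

open ProbabilityTheory Real
open scoped BigOperators

variable {Ω ι : Type*} [MeasurableSpace Ω] [Fintype ι] [DecidableEq ι]

/-- Real linear combinations of the `u j` have subgaussian tails with constant `C`. -/
def SubgaussianTail (μ : Measure Ω) (u : ι → Ω → ℝ) (C : ℝ) : Prop :=
  ∀ (a : ι → ℝ) (A τ : ℝ), 0 < A → 0 ≤ τ → ∑ j, a j ^ 2 ≤ A →
    μ.real {x | τ ≤ ∑ j, a j * u j x} ≤ 2 * exp (-(τ ^ 2 / (C ^ 2 * A)))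

/-- The random sum `∑_{j ∈ S} ε_j u_j`. -/
def signSum (u : ι → Ω → ℝ) (S : Finset ι) (ε : ι → ℤˣ) (x : Ω) : ℝ :=
  ∑ j ∈ S, sgn ε j * u j x

variable {μ : Measure Ω} {u : ι → Ω → ℝ} {M C : ℝ}

omit [Fintype ι] [DecidableEq ι] in
theorem measurable_signSum (hu : ∀ j, Measurable (u j)) (S : Finset ι) (ε : ι → ℤˣ) :
    Measurable (signSum u S ε) := by
  unfold signSum
  exact Finset.measurable_sum S fun j _ => (hu j).const_mul _

omit [MeasurableSpace Ω] [Fintype ι] [DecidableEq ι] in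
theorem abs_signSum_le (hM : ∀ j x, |u j x| ≤ M) (S : Finset ι) (ε : ι → ℤˣ) (x : Ω) :
    |signSum u S ε x| ≤ M * S.card := by
  refine (Finset.abs_sum_le_sum_abs _ _).trans ?_
  refine (Finset.sum_le_card_nsmul S _ M fun j _ => ?_).trans (by simp [mul_comm])
  rw [abs_mul, abs_sgn, one_mul]
  exact hM j x

/-- A measure with bounded density has small mean vector on every block. -/
theorem sum_sq_integral_le [IsProbabilityMeasure μ] {G : Measure Ω} [IsProbabilityMeasure G]
    (hu : ∀ j, Measurable (u j)) (hM : ∀ j x, |u j x| ≤ M) (hM0 : 0 < M)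
    (ht : SubgaussianTail μ u C) {D τ n : ℝ} (hD : 0 ≤ D) (hτ : 0 ≤ τ) (hn : 0 < n)
    (hG : ∀ B, MeasurableSet B → G.real B ≤ D * μ.real B) (B : Finset ι) (hB : (B.card : ℝ) ≤ n) :
    ∑ j ∈ B, (∫ x, u j x ∂G) ^ 2 ≤
      τ + M ^ 2 * n * (D * (2 * exp (-(τ ^ 2 / (C ^ 2 * (M ^ 2 * n)))))) := by
  classical
  -- Self-testing: with the means themselves as coefficients, the `G`-mean of `Y` is the sum of
  -- their squares. Under `μ` the function `Y` rarely exceeds `τ`, and the density bound carries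
  -- this over to `G`.
  set a : ι → ℝ := fun j => if j ∈ B then ∫ x, u j x ∂G else 0 with ha
  have hab : ∀ j, |∫ x, u j x ∂G| ≤ M := fun j => abs_integral_le_of_abs_le (hM j)
  have haS : ∑ j, a j ^ 2 ≤ M ^ 2 * n := by
    have : ∑ j, a j ^ 2 = ∑ j ∈ B, (∫ x, u j x ∂G) ^ 2 := by
      simp [ha, ite_pow, Finset.sum_ite_mem]
    rw [this]
    refine (Finset.sum_le_card_nsmul B _ (M ^ 2) fun j _ => ?_).trans ?_
    · rw [← sq_abs]; exact pow_le_pow_left₀ (abs_nonneg _) (hab j) 2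
    · rw [nsmul_eq_mul, mul_comm]; exact mul_le_mul_of_nonneg_left hB (sq_nonneg M)
  set Y : Ω → ℝ := fun x => ∑ j, a j * u j x with hY
  have hYm : Measurable Y := Finset.measurable_sum _ fun j _ => (hu j).const_mul _
  have hYe : ∀ x, Y x = ∑ j ∈ B, (∫ x, u j x ∂G) * u j x := fun x => by
    simp [hY, ha, ite_mul, Finset.sum_ite_mem]
  have hYb : ∀ x, |Y x| ≤ M ^ 2 * n := fun x => by
    rw [hYe]
    refine (Finset.abs_sum_le_sum_abs _ _).trans
      ((Finset.sum_le_card_nsmul B _ (M ^ 2) fun j _ => ?_).trans ?_)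
    · rw [abs_mul, sq]; exact mul_le_mul (hab j) (hM j x) (abs_nonneg _) hM0.le
    · rw [nsmul_eq_mul, mul_comm]; exact mul_le_mul_of_nonneg_left hB (sq_nonneg M)
  set E : Set Ω := {x | τ ≤ Y x} with hE
  have hEm : MeasurableSet E := measurableSet_le measurable_const hYm
  have h1 : ∑ j ∈ B, (∫ x, u j x ∂G) ^ 2 = ∫ x, Y x ∂G := by
    simp_rw [hYe]
    rw [integral_finsetSum]
    · exact Finset.sum_congr rfl fun j _ => by rw [integral_const_mul, sq]
    · exact fun j _ => (integrable_of_abs_le (hu j) (hM j)).const_mul _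
  have h2 : ∫ x, Y x ∂G ≤ ∫ x, (τ + E.indicator (fun _ => M ^ 2 * n) x) ∂G := by
    refine integral_mono (integrable_of_abs_le hYm hYb)
      ((integrable_const _).add ((integrable_const _).indicator hEm)) fun x => ?_
    by_cases hx : x ∈ E
    · simp only [Set.indicator_of_mem hx]; linarith [(abs_le.1 (hYb x)).2]
    · simp only [Set.indicator_of_notMem hx, add_zero]
      exact (not_le.1 hx).le
  have h3 : ∫ x, (τ + E.indicator (fun _ => M ^ 2 * n) x) ∂G = τ + M ^ 2 * n * G.real E := by
    rw [integral_add (integrable_const _) ((integrable_const _).indicator hEm),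
      integral_indicator_const _ hEm]
    simp [mul_comm]
  rw [h1]
  refine h2.trans (h3.trans_le ?_)
  have h4 : 0 < M ^ 2 * n := by positivity
  gcongr
  exact (hG E hEm).trans (mul_le_mul_of_nonneg_left (ht a _ τ h4 hτ haS) hD)

end Block

/-! ### Growth of the mean free energy on one block -/

section BlockSelection

open ProbabilityTheory Real
open scoped BigOperators

variable {Ω ι : Type*} [MeasurableSpace Ω] [Fintype ι] [DecidableEq ι]
variable {μ P : Measure Ω} {u : ι → Ω → ℝ} {M C : ℝ}

/-- The mean free energy of the random sums over `S` at inverse temperature `l`. -/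
noncomputable def freeEnergy (P : Measure Ω) (u : ι → Ω → ℝ) (l : ℝ) (S : Finset ι) : ℝ :=
  𝔼 ε, log (∫ x, exp (l * signSum u S ε x) ∂P)

omit [MeasurableSpace Ω] [Fintype ι] in
theorem signSum_insert {S : Finset ι} {j : ι} (hj : j ∉ S) (ε : ι → ℤˣ) (x : Ω) :
    signSum u (insert j S) ε x = signSum u S ε x + sgn ε j * u j x := by
  rw [signSum, Finset.sum_insert hj, add_comm, signSum]

omit [MeasurableSpace Ω] [Fintype ι] [DecidableEq ι] in
theorem signSum_congr {S : Finset ι} {ε ε' : ι → ℤˣ} (h : ∀ j ∈ S, ε j = ε' j) (x : Ω) :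
    signSum u S ε x = signSum u S ε' x :=
  Finset.sum_congr rfl fun j hj => by rw [sgn, sgn, h j hj]

omit [Fintype ι] in
theorem flipSign_apply_of_ne (ε : ι → ℤˣ) {i j : ι} (h : i ≠ j) : flipSign j ε i = ε i := by
  simp [flipSign, h]

omit [MeasurableSpace Ω] [Fintype ι] [DecidableEq ι] in
theorem abs_mul_signSum_le (hM : ∀ j x, |u j x| ≤ M) {l : ℝ} (hl : 0 ≤ l) (S : Finset ι)
    (ε : ι → ℤˣ) (x : Ω) : |l * signSum u S ε x| ≤ l * (M * S.card) := by
  rw [abs_mul, abs_of_nonneg hl]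
  exact mul_le_mul_of_nonneg_left (abs_signSum_le hM S ε x) hl

omit [Fintype ι] [DecidableEq ι] in
theorem isProbabilityMeasure_tilted_signSum [IsProbabilityMeasure P]
    (hu : ∀ j, Measurable (u j)) (hM : ∀ j x, |u j x| ≤ M) {l : ℝ} (hl : 0 ≤ l) (S : Finset ι)
    (ε : ι → ℤˣ) : IsProbabilityMeasure (P.tilted fun x => l * signSum u S ε x) :=
  isProbabilityMeasure_tilted (integrable_exp_of_abs_le
    ((measurable_signSum hu S ε).const_mul l) (abs_mul_signSum_le hM hl S ε))

/-- The chain rule reduces the new sign to a log-Laplace transform under the Gibbs measure of `S`.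
Its linear term is odd in `ε_j`, since that Gibbs measure does not see `ε_j`, so it averages out and
only the variance gain remains. -/
theorem freeEnergy_insert_ge [IsProbabilityMeasure P]
    (hu : ∀ j, Measurable (u j)) (hM : ∀ j x, |u j x| ≤ M) {l : ℝ} (hl : 0 ≤ l)
    (hlM : l * (2 * M) ≤ 1) {S : Finset ι} {j : ι} (hj : j ∉ S) :
    freeEnergy P u l S +
        l ^ 2 / 8 * 𝔼 ε, Var[u j; P.tilted fun x => l * signSum u S ε x] ≤
      freeEnergy P u l (insert j S) := by
  have h0 : 𝔼 ε : ι → ℤˣ, l * sgn ε j * ∫ x, u j x ∂(P.tilted fun x => l * signSum u S ε x) = 0 := by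
    refine expect_eq_zero_of_flipSign j _ fun ε => ?_
    have : ∀ x, signSum u S (flipSign j ε) x = signSum u S ε x :=
      signSum_congr fun i hi => flipSign_apply_of_ne ε fun h => hj (h ▸ hi)
    simp_rw [this, sgn_flipSign_self]
    ring
  rw [freeEnergy, freeEnergy, Finset.mul_expect, ← Finset.expect_add_distrib,
    ← add_zero (𝔼 ε : ι → ℤˣ, _), ← h0, ← Finset.expect_add_distrib]
  refine Finset.expect_le_expect fun ε _ => ?_
  have := isProbabilityMeasure_tilted_signSum (P := P) hu hM hl S ε
  have h1 := le_log_integral_exp (G := P.tilted fun x => l * signSum u S ε x) (hu j) (hM j)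
    (t := l * sgn ε j) (by rw [abs_mul, abs_sgn, mul_one, abs_of_nonneg hl]; exact hlM)
  have h2 := log_integral_exp_add (P := P) (f := fun x => l * signSum u S ε x)
    (g := fun x => l * sgn ε j * u j x) (b := l * M)
    ((measurable_signSum hu S ε).const_mul l) (abs_mul_signSum_le hM hl S ε)
    ((hu j).const_mul _) fun x => by
      rw [abs_mul, abs_mul, abs_sgn, mul_one, abs_of_nonneg hl]
      exact mul_le_mul_of_nonneg_left (hM j x) hl
  have h3 : ∀ x, l * signSum u (insert j S) ε x =
      l * signSum u S ε x + l * sgn ε j * u j x := fun x => by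
    rw [signSum_insert hj]; ring
  simp_rw [h3]
  rw [h2]
  have h4 : (l * sgn ε j) ^ 2 = l ^ 2 := by
    rw [mul_pow, sq (sgn ε j), sgn_mul_self, mul_one]
  rw [h4] at h1
  linarith

theorem freeEnergy_mono [IsProbabilityMeasure P]
    (hu : ∀ j, Measurable (u j)) (hM : ∀ j x, |u j x| ≤ M) {l : ℝ} (hl : 0 ≤ l)
    (hlM : l * (2 * M) ≤ 1) {S A : Finset ι} (hSA : S ⊆ A) :
    freeEnergy P u l S ≤ freeEnergy P u l A := by
  have key : ∀ T : Finset ι, freeEnergy P u l S ≤ freeEnergy P u l (T ∪ S) := by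
    intro T
    induction T using Finset.induction_on with
    | empty => simp
    | insert j T _ ih =>
      rw [Finset.insert_union]
      by_cases h : j ∈ T ∪ S
      · rwa [Finset.insert_eq_of_mem h]
      · refine ih.trans (le_trans ?_ (freeEnergy_insert_ge hu hM hl hlM h))
        exact le_add_of_nonneg_right (mul_nonneg (by positivity)
          (Finset.expect_nonneg fun _ _ => variance_nonneg _ _))
  simpa [Finset.union_eq_left.2 hSA] using key A

/-- Discarding `S` costs at most half of the second moments, leaving `ρn/2`; the squared means take
at most `ρn/4 + ρn/8`, with `n` the size of `A`. -/
theorem sum_variance_ge [IsProbabilityMeasure μ] {G : Measure Ω} [IsProbabilityMeasure G]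
    (hu : ∀ j, Measurable (u j)) (hM : ∀ j x, |u j x| ≤ M) (hM0 : 0 < M) (hC : 0 < C)
    (ht : SubgaussianTail μ u C) {ρ β : ℝ} (hρ : 0 < ρ)
    (hβ : β = ρ ^ 2 / (32 * C ^ 2 * M ^ 2)) {A S : Finset ι} (hSA : S ⊆ A)
    (hA : 0 < A.card) (hn : exp (-(β * A.card)) ≤ ρ / (16 * M ^ 2))
    (hG : ∀ B, MeasurableSet B → G.real B ≤ exp (β * A.card) * μ.real B)
    (hq : ∀ᵐ x ∂G, ρ * A.card ≤ ∑ j ∈ A, u j x ^ 2)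
    (hS : (S.card : ℝ) * M ^ 2 ≤ ρ * A.card / 2) :
    ρ * A.card / 8 ≤ ∑ j ∈ A \ S, Var[u j; G] := by
  have hn0 : (0 : ℝ) < A.card := by exact_mod_cast hA
  generalize hnd : (A.card : ℝ) = n at *
  have hcard : ((A \ S).card : ℝ) ≤ n := by
    rw [← hnd]; exact_mod_cast Finset.card_le_card Finset.sdiff_subset
  have h1 := sum_sq_integral_le hu hM hM0 ht (exp_pos (β * n)).le
    (τ := ρ * n / 4) (by positivity) hn0 hG (A \ S) hcard
  -- This fixes `β`: at level `τ = ρn/4` the tail exponent is exactly `2βn`, twice the exponent of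
  -- the density bound.
  have h2 : (ρ * n / 4) ^ 2 / (C ^ 2 * (M ^ 2 * n)) = 2 * (β * n) := by
    rw [hβ]; field_simp; ring
  have h3 : exp (β * n) * (2 * exp (-(2 * (β * n)))) = 2 * exp (-(β * n)) := by
    rw [mul_left_comm, ← exp_add]; ring_nf
  rw [h2, h3] at h1
  have h4 : M ^ 2 * n * (2 * exp (-(β * n))) ≤ ρ * n / 8 := by
    calc M ^ 2 * n * (2 * exp (-(β * n))) ≤ M ^ 2 * n * (2 * (ρ / (16 * M ^ 2))) := by gcongr
      _ = ρ * n / 8 := by field_simp; ring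
  have hint : ∀ j, Integrable (fun x => u j x ^ 2) G := fun j =>
    integrable_of_abs_le (b := M ^ 2) ((hu j).pow_const 2) fun x => by
      rw [abs_of_nonneg (sq_nonneg _), ← sq_abs]
      exact pow_le_pow_left₀ (abs_nonneg _) (hM j x) 2
  have h5 : ρ * n / 2 ≤ ∑ j ∈ A \ S, ∫ x, u j x ^ 2 ∂G := by
    rw [← integral_finsetSum _ fun j _ => hint j]
    have : ∫ _, ρ * n / 2 ∂G ≤ ∫ x, ∑ j ∈ A \ S, u j x ^ 2 ∂G := by
      refine integral_mono_ae (integrable_const _) (integrable_finsetSum _ fun j _ => hint j) ?_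
      filter_upwards [hq] with x hx
      have e1 := Finset.sum_sdiff (f := fun j => u j x ^ 2) hSA
      have e2 : ∑ j ∈ S, u j x ^ 2 ≤ S.card * M ^ 2 := by
        refine (Finset.sum_le_card_nsmul S _ (M ^ 2) fun j _ => ?_).trans (by simp)
        rw [← sq_abs]; exact pow_le_pow_left₀ (abs_nonneg _) (hM j x) 2
      linarith
    simpa using this
  have h6 : ∀ j, Var[u j; G] = ∫ x, u j x ^ 2 ∂G - (∫ x, u j x ∂G) ^ 2 := fun j => by
    have := variance_eq_sub (X := u j) (μ := G)
      (MemLp.of_bound (hu j).aestronglyMeasurable M (Filter.Eventually.of_forall (hM j)))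
    simpa using this
  simp_rw [h6]
  rw [Finset.sum_sub_distrib]
  linarith

/-- Greedy choice: while `S` is small, the averaged Gibbs variances over `A \ S` sum to at least
`ρn/8`, so some index has `ρ/8`, and adding it gains `(l²/8)(ρ/8)`. The slack `M ^ 2` in the
hypothesis on `m` allows one last step once `S` has reached the critical size. -/
theorem exists_freeEnergy_ge [IsProbabilityMeasure μ] [IsProbabilityMeasure P]
    (hu : ∀ j, Measurable (u j)) (hM : ∀ j x, |u j x| ≤ M) (hM0 : 0 < M) (hC : 0 < C)
    (ht : SubgaussianTail μ u C) {ρ β l : ℝ} (hρ : 0 < ρ) (hρM : ρ ≤ M ^ 2)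
    (hβ : β = ρ ^ 2 / (32 * C ^ 2 * M ^ 2)) (hl : 0 ≤ l) (hlM : l * (2 * M) ≤ 1)
    (hlβ : 2 * (l * M) ≤ β / 2) {A : Finset ι}
    (hA : 0 < A.card) (hn : exp (-(β * A.card)) ≤ ρ / (16 * M ^ 2))
    (hP : ∀ B, MeasurableSet B → P.real B ≤ exp (β / 2 * A.card) * μ.real B)
    (hq : ∀ᵐ x ∂P, ρ * A.card ≤ ∑ j ∈ A, u j x ^ 2) (m : ℕ)
    (hm : (m : ℝ) * M ^ 2 ≤ ρ * A.card / 2 + M ^ 2) :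
    ∃ S ⊆ A, S.card = m ∧ m * (l ^ 2 * ρ / 64) ≤ freeEnergy P u l S := by
  induction m with
  | zero =>
    refine ⟨∅, by simp, by simp, ?_⟩
    simp [freeEnergy, signSum]
  | succ m ih =>
    push_cast at hm
    have hm' : (m : ℝ) * M ^ 2 ≤ ρ * A.card / 2 := by linarith
    obtain ⟨S, hSA, hSm, hS⟩ := ih (by nlinarith [sq_nonneg M])
    have hnA : (0 : ℝ) < A.card := by exact_mod_cast hA
    have key : ρ * A.card / 8 ≤
        ∑ j ∈ A \ S, 𝔼 ε, Var[u j; P.tilted fun x => l * signSum u S ε x] := by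
      rw [← Finset.expect_sum_comm]
      refine Finset.le_expect Finset.univ_nonempty fun ε _ => ?_
      have := isProbabilityMeasure_tilted_signSum (P := P) hu hM hl S ε
      refine sum_variance_ge hu hM hM0 hC ht hρ hβ hSA hA hn (fun B hB => ?_)
        ((tilted_absolutelyContinuous P _).ae_le hq) (by rw [hSm]; exact hm')
      -- The density budget `e^{βn}` is split evenly: half is already spent by `P`, half pays for
      -- the tilt because `2lM ≤ β/2`.
      refine (tilted_real_le ((measurable_signSum hu S ε).const_mul l)
        (abs_mul_signSum_le hM hl S ε) hB).trans ?_
      refine (mul_le_mul_of_nonneg_left (hP B hB) (exp_pos _).le).trans ?_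
      rw [← mul_assoc, ← exp_add]
      refine mul_le_mul_of_nonneg_right (exp_le_exp.2 ?_) measureReal_nonneg
      have h1 : (S.card : ℝ) ≤ A.card := by exact_mod_cast Finset.card_le_card hSA
      calc 2 * (l * (M * S.card)) + β / 2 * A.card
          = 2 * (l * M) * S.card + β / 2 * A.card := by ring
        _ ≤ 2 * (l * M) * A.card + β / 2 * A.card := by gcongr
        _ ≤ β / 2 * A.card + β / 2 * A.card := by gcongr
        _ = β * A.card := by ring
    obtain ⟨j, hj, hjv⟩ : ∃ j ∈ A \ S,
        ρ / 8 ≤ 𝔼 ε, Var[u j; P.tilted fun x => l * signSum u S ε x] := by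
      by_contra! hc
      have h1 : ∑ j ∈ A \ S, 𝔼 ε, Var[u j; P.tilted fun x => l * signSum u S ε x] <
          ρ * A.card / 8 := by
        have hne : (A \ S).Nonempty := by
          rw [Finset.nonempty_iff_ne_empty]
          intro he
          rw [he, Finset.sum_empty] at key
          nlinarith
        calc _ < ∑ j ∈ A \ S, ρ / 8 := Finset.sum_lt_sum_of_nonempty hne hc
          _ = (A \ S).card * (ρ / 8) := by simp
          _ ≤ A.card * (ρ / 8) := by
            gcongr
            exact Finset.sdiff_subset
          _ = _ := by ring
      linarith
    rw [Finset.mem_sdiff] at hj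
    refine ⟨insert j S, Finset.insert_subset hj.1 hSA, by
      rw [Finset.card_insert_of_notMem hj.2, hSm], ?_⟩
    refine le_trans ?_ (freeEnergy_insert_ge hu hM hl hlM hj.2)
    have h2 : l ^ 2 / 8 * (ρ / 8) ≤
        l ^ 2 / 8 * 𝔼 ε, Var[u j; P.tilted fun x => l * signSum u S ε x] := by gcongr
    push_cast
    linarith

theorem freeEnergy_ge [IsProbabilityMeasure μ] [IsProbabilityMeasure P]
    (hu : ∀ j, Measurable (u j)) (hM : ∀ j x, |u j x| ≤ M) (hM0 : 0 < M) (hC : 0 < C)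
    (ht : SubgaussianTail μ u C) {ρ β l : ℝ} (hρ : 0 < ρ) (hρM : ρ ≤ M ^ 2)
    (hβ : β = ρ ^ 2 / (32 * C ^ 2 * M ^ 2)) (hl : 0 ≤ l) (hlM : l * (2 * M) ≤ 1)
    (hlβ : 2 * (l * M) ≤ β / 2) {A : Finset ι}
    (hA : 0 < A.card) (hn : exp (-(β * A.card)) ≤ ρ / (16 * M ^ 2))
    (hP : ∀ B, MeasurableSet B → P.real B ≤ exp (β / 2 * A.card) * μ.real B)
    (hq : ∀ᵐ x ∂P, ρ * A.card ≤ ∑ j ∈ A, u j x ^ 2) :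
    l ^ 2 * ρ ^ 2 / (128 * M ^ 2) * A.card ≤ freeEnergy P u l A := by
  have hr : 0 ≤ ρ * A.card / (2 * M ^ 2) := by positivity
  -- The floor plus one makes the number of greedy steps at least `ρn/(2M²)`. Monotonicity then
  -- passes from `S` to all of `A`.
  obtain ⟨S, hSA, -, hS⟩ := exists_freeEnergy_ge hu hM hM0 hC ht hρ hρM hβ hl hlM hlβ hA hn hP hq
    (⌊ρ * A.card / (2 * M ^ 2)⌋₊ + 1) (by
      push_cast
      have h1 := Nat.floor_le hr
      have h2 : ρ * A.card / (2 * M ^ 2) * M ^ 2 = ρ * A.card / 2 := by field_simp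
      nlinarith [mul_le_mul_of_nonneg_right h1 (sq_nonneg M)])
  refine le_trans (le_trans ?_ hS) (freeEnergy_mono hu hM hl hlM hSA)
  push_cast
  calc l ^ 2 * ρ ^ 2 / (128 * M ^ 2) * A.card
      = ρ * A.card / (2 * M ^ 2) * (l ^ 2 * ρ / 64) := by field_simp; ring
    _ ≤ _ := mul_le_mul_of_nonneg_right (Nat.lt_floor_add_one _).le (by positivity)

end BlockSelection

/-! ### Selecting sets along successive blocks -/

section MultiBlock

open ProbabilityTheory Real
open scoped BigOperators

variable {Ω ι : Type*} [MeasurableSpace Ω] [Fintype ι] [DecidableEq ι]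
variable {μ : Measure Ω} {u : ι → Ω → ℝ} {M C : ℝ}

/-- Condition on `U` and cut at a threshold slightly below free energy over `l`. A large exponential
moment of a bounded variable forces the superlevel set to have mass at least `e^{-O(n)}`. Everything
depends on `ε` only through its restriction to `A`, which keeps different blocks independent. -/
theorem exists_block_selection [IsProbabilityMeasure μ]
    (hu : ∀ j, Measurable (u j)) (hM : ∀ j x, |u j x| ≤ M) (hM0 : 0 < M) (hC : 0 < C)
    (ht : SubgaussianTail μ u C) {ρ β l : ℝ} (hρ : 0 < ρ) (hρM : ρ ≤ M ^ 2)
    (hβ : β = ρ ^ 2 / (32 * C ^ 2 * M ^ 2)) (hl : 0 < l) (hlM : l * (2 * M) ≤ 1)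
    (hlβ : 2 * (l * M) ≤ β / 2) {A : Finset ι}
    (hA : 0 < A.card) (hn : exp (-(β * A.card)) ≤ ρ / (16 * M ^ 2))
    (hn' : log 2 / l ≤ l * ρ ^ 2 / (256 * M ^ 2) * A.card)
    {U : Set Ω} (hUm : MeasurableSet U) (hU : exp (-(β / 2 * A.card)) ≤ μ.real U)
    (hq : ∀ x ∈ U, ρ * A.card ≤ ∑ j ∈ A, u j x ^ 2) :
    ∃ (V : (ι → ℤˣ) → Set Ω) (T : (ι → ℤˣ) → ℝ),
      (∀ ε, MeasurableSet (V ε)) ∧ (∀ ε, V ε ⊆ U) ∧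
      (∀ ε, 2⁻¹ * exp (-(2 * (l * (M * A.card)))) * μ.real U ≤ μ.real (V ε)) ∧
      (∀ ε ε', (∀ j ∈ A, ε j = ε' j) → V ε = V ε') ∧
      (∀ ε, ∀ x ∈ V ε, T ε ≤ signSum u A ε x) ∧
      l * ρ ^ 2 / (256 * M ^ 2) * A.card ≤ 𝔼 ε, T ε := by
  have hU0 : 0 < μ.real U := (exp_pos _).trans_le hU
  have hμU : μ U ≠ 0 := fun h => by simp [measureReal_def, h] at hU0
  have := cond_isProbabilityMeasure (μ := μ) hμU
  have hPr : ∀ B, (μ[|U]).real B = (μ.real U)⁻¹ * μ.real (U ∩ B) := fun B => by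
    simp [measureReal_def, cond_apply hUm]
  have hF := freeEnergy_ge (P := μ[|U]) hu hM hM0 hC ht hρ hρM hβ hl.le hlM hlβ hA hn
    (fun B _ => by
      rw [hPr]
      refine mul_le_mul ?_ (measureReal_mono Set.inter_subset_right) measureReal_nonneg
        (exp_pos _).le
      rw [inv_le_comm₀ hU0 (exp_pos _), ← exp_neg]
      exact hU)
    (by filter_upwards [ae_cond_mem hUm] with x hx using hq x hx)
  set F : (ι → ℤˣ) → ℝ := fun ε => log (∫ x, exp (l * signSum u A ε x) ∂μ[|U]) with hFd
  -- Below this level the exponential is at most half its mean `Z`. The loss `log 2 / l` is half of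
  -- the expected gain at most, by `hn'`.
  set T : (ι → ℤˣ) → ℝ := fun ε => (F ε - log 2) / l with hT
  set b : ℝ := l * (M * A.card) with hb
  have hXm : ∀ ε, Measurable fun x => l * signSum u A ε x := fun ε =>
    (measurable_signSum hu A ε).const_mul l
  have hXb : ∀ ε x, |l * signSum u A ε x| ≤ b := fun ε => abs_mul_signSum_le hM hl.le A ε
  have hi : ∀ ε, Integrable (fun x => exp (l * signSum u A ε x)) (μ[|U]) := fun ε =>
    integrable_exp_of_abs_le (hXm ε) (hXb ε)
  have hS : ∀ ε, MeasurableSet {x | T ε ≤ signSum u A ε x} := fun ε =>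
    measurableSet_le measurable_const (measurable_signSum hu A ε)
  refine ⟨fun ε => U ∩ {x | T ε ≤ signSum u A ε x}, T, fun ε => hUm.inter (hS ε),
    fun ε => Set.inter_subset_left, fun ε => ?_, fun ε ε' h => ?_, fun ε x hx => hx.2, ?_⟩
  · have hZ : exp (-b) ≤ ∫ x, exp (l * signSum u A ε x) ∂μ[|U] := by
      have : ∫ _, exp (-b) ∂μ[|U] ≤ ∫ x, exp (l * signSum u A ε x) ∂μ[|U] :=
        integral_mono (integrable_const _) (hi ε) fun x => exp_le_exp.2 (abs_le.1 (hXb ε x)).1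
      simpa using this
    set Z := ∫ x, exp (l * signSum u A ε x) ∂μ[|U] with hZd
    have hZ0 : 0 < Z := (exp_pos _).trans_le hZ
    set E : Set Ω := {x | T ε ≤ signSum u A ε x} with hE
    have h1 : Z ≤ ∫ x, (Z / 2 + E.indicator (fun _ => exp b) x) ∂μ[|U] := by
      refine integral_mono (hi ε)
        ((integrable_const _).add ((integrable_const _).indicator (hS ε))) fun x => ?_
      by_cases hx : x ∈ E
      · simp only [Set.indicator_of_mem hx]
        have := exp_le_exp.2 (abs_le.1 (hXb ε x)).2
        linarith
      · simp only [Set.indicator_of_notMem hx, add_zero]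
        have h2 : signSum u A ε x < (F ε - log 2) / l := not_le.1 hx
        rw [lt_div_iff₀ hl, mul_comm] at h2
        refine (exp_le_exp.2 h2.le).trans ?_
        rw [exp_sub, exp_log hZ0, exp_log two_pos]
    have h2 : ∫ x, (Z / 2 + E.indicator (fun _ => exp b) x) ∂μ[|U] =
        Z / 2 + exp b * (μ[|U]).real E := by
      rw [integral_add (integrable_const _) ((integrable_const _).indicator (hS ε)),
        integral_indicator_const _ (hS ε)]
      simp [mul_comm]
      rfl
    have h3 : exp (-(2 * b)) / 2 ≤ (μ[|U]).real E := by
      have h4 : exp (-b) / 2 ≤ exp b * (μ[|U]).real E := by linarith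
      have h5 : exp (-(2 * b)) / 2 = exp (-b) * (exp (-b) / 2) := by
        rw [mul_div_assoc', ← exp_add]; ring_nf
      rw [h5]
      calc exp (-b) * (exp (-b) / 2) ≤ exp (-b) * (exp b * (μ[|U]).real E) := by gcongr
        _ = (μ[|U]).real E := by rw [← mul_assoc, ← exp_add]; simp
    rw [hPr, ← div_eq_inv_mul, le_div_iff₀ hU0] at h3
    linarith
  · have hs : ∀ x, signSum u A ε x = signSum u A ε' x := signSum_congr h
    have hTe : T ε = T ε' := by simp only [hT, hFd, hs]
    simp only [hTe, hs]
  · have h1 : 𝔼 ε, T ε = freeEnergy (μ[|U]) u l A / l - log 2 / l := by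
      rw [hT]
      simp_rw [sub_div]
      rw [Finset.expect_sub_distrib, ← Finset.expect_div, Fintype.expect_const]
      rfl
    have h2 : l ^ 2 * ρ ^ 2 / (128 * M ^ 2) * A.card / l =
        2 * (l * ρ ^ 2 / (256 * M ^ 2) * A.card) := by field_simp; ring
    have h3 := div_le_div_of_nonneg_right hF hl.le
    rw [h1]
    linarith

omit [Fintype ι] [DecidableEq ι] in
theorem integral_signSum (P : Measure Ω) [IsFiniteMeasure P] (hu : ∀ j, Measurable (u j))
    (hM : ∀ j x, |u j x| ≤ M) (A : Finset ι) (ε : ι → ℤˣ) :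
    ∫ x, signSum u A ε x ∂P = ∑ j ∈ A, sgn ε j * ∫ x, u j x ∂P := by
  simp only [signSum]
  rw [integral_finsetSum _ fun j _ => (integrable_of_abs_le (hu j) (hM j)).const_mul _]
  simp_rw [integral_const_mul]

/-- Successive selection along blocks of rapidly growing size. -/
theorem exists_multiblock_selection [IsProbabilityMeasure μ]
    (hu : ∀ j, Measurable (u j)) (hM : ∀ j x, |u j x| ≤ M) (hM0 : 0 < M) (hC : 0 < C)
    (ht : SubgaussianTail μ u C) {ρ β l : ℝ} (hρ : 0 < ρ) (hρM : ρ ≤ M ^ 2)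
    (hβ : β = ρ ^ 2 / (32 * C ^ 2 * M ^ 2)) (hl : 0 < l) (hlM : l * (2 * M) ≤ 1)
    (hlβ : 2 * (l * M) ≤ β / 2) {A : ℕ → Finset ι} {a : ℕ → ℝ} {L : ℕ} (ha : ∀ k, 0 ≤ a k)
    (hdisj : ∀ i k, i < k → Disjoint (A i) (A k))
    (hA : ∀ k < L, 0 < (A k).card)
    (hn : ∀ k < L, exp (-(β * (A k).card)) ≤ ρ / (16 * M ^ 2))
    (hn' : ∀ k < L, log 2 / l ≤ l * ρ ^ 2 / (256 * M ^ 2) * (A k).card)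
    (hgrow : ∀ k, k + 1 < L → 2 * exp (-(β / 2 * (A (k + 1)).card)) ≤
      2⁻¹ * exp (-(2 * (l * (M * (A k).card)))) * exp (-(β / 2 * (A k).card)))
    (d : ℕ) : ∀ k, k + d = L → ∀ (U : Set Ω) (θ : ℝ), MeasurableSet U → 0 < μ.real U →
      (k < L → 2 * exp (-(β / 2 * (A k).card)) ≤ μ.real U) →
      (∀ x ∈ U, θ ≤ ∑ i ∈ Finset.Ico k L, a i * ∑ j ∈ A i, u j x ^ 2) →
      ∃ V : (ι → ℤˣ) → Set Ω, (∀ ε, MeasurableSet (V ε)) ∧ (∀ ε, V ε ⊆ U) ∧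
        (∀ ε, 0 < μ.real (V ε)) ∧
        (∀ ε ε', (∀ i ∈ Finset.Ico k L, ∀ j ∈ A i, ε j = ε' j) → V ε = V ε') ∧
        l * ρ ^ 2 / (256 * M ^ 2) / M ^ 2 *
            (θ - ρ * ∑ i ∈ Finset.Ico k L, a i * (A i).card) ≤
          𝔼 ε, ∑ i ∈ Finset.Ico k L, a i * ∫ x, signSum u (A i) ε x ∂μ[|V ε] := by
  set c : ℝ := l * ρ ^ 2 / (256 * M ^ 2) with hc
  have hc0 : 0 < c := by positivity
  induction d with
  | zero =>
    rintro k rfl U θ hUm hU0 - hθ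
    refine ⟨fun _ => U, fun _ => hUm, fun _ => subset_rfl, fun _ => hU0, fun _ _ _ => rfl, ?_⟩
    -- No block is left, so any point of `U` witnesses `θ ≤ 0`.
    obtain ⟨x, hx⟩ : U.Nonempty := by
      rw [Set.nonempty_iff_ne_empty]; rintro rfl; simp at hU0
    have := hθ x hx
    simp only [add_zero, Finset.Ico_self, Finset.sum_empty, mul_zero, sub_zero,
      Finset.expect_const_zero] at this ⊢
    exact mul_nonpos_of_nonneg_of_nonpos (by positivity) this
  | succ d ih =>
    intro k hk U θ hUm hU0 hUk hθ
    have hkL : k < L := by omega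
    have hUk := hUk hkL
    have hsplit : ∀ f : ℕ → ℝ, ∑ i ∈ Finset.Ico k L, f i =
        f k + ∑ i ∈ Finset.Ico (k + 1) L, f i := fun f => Finset.sum_eq_sum_Ico_succ_bot hkL f
    have hsub : ∀ i ∈ Finset.Ico (k + 1) L, i ∈ Finset.Ico k L := fun i hi => by
      simp only [Finset.mem_Ico] at hi ⊢; omega
    have hdis : ∀ i ∈ Finset.Ico (k + 1) L, ∀ j ∈ A i, j ∉ A k := fun i hi j hj hjk =>
      Finset.disjoint_left.1 (hdisj k i (by simp only [Finset.mem_Ico] at hi; omega)) hjk hj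
    have hih := ih (k + 1) (by omega)
    simp_rw [hsplit] at hθ ⊢
    set q : Ω → ℝ := fun x => ∑ j ∈ A k, u j x ^ 2 with hq
    have hqm : Measurable q := Finset.measurable_sum _ fun j _ => (hu j).pow_const 2
    have hqM : ∀ x, q x ≤ (A k).card * M ^ 2 := fun x => by
      refine (Finset.sum_le_card_nsmul _ _ (M ^ 2) fun j _ => ?_).trans (by simp)
      rw [← sq_abs]; exact pow_le_pow_left₀ (abs_nonneg _) (hM j x) 2
    set n : ℝ := ((A k).card : ℝ) with hnd
    set rest : ℝ := ∑ i ∈ Finset.Ico (k + 1) L, a i * (A i).card with hrest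
    set Up : Set Ω := U ∩ {x | ρ * n ≤ q x} with hUp
    set Um : Set Ω := U \ {x | ρ * n ≤ q x} with hUmd
    have hqs : MeasurableSet {x | ρ * n ≤ q x} := measurableSet_le measurable_const hqm
    have hsum : μ.real Up + μ.real Um = μ.real U := measureReal_inter_add_sdiff hqs
    have hann : 0 ≤ a k * n := mul_nonneg (ha k) (by positivity)
    -- One half of `U` is kept. If the quadratic sum of the block is large there, select: `θ` drops
    -- by at most `M² a_k n` and the correlation gains `c a_k n`. Otherwise skip the block: `θ` and
    -- the subtracted `ρ`-sum both drop by `ρ a_k n`, so nothing is lost.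
    by_cases hcase : μ.real U / 2 ≤ μ.real Up
    · have hUpm : MeasurableSet Up := hUm.inter hqs
      have hUpb : exp (-(β / 2 * n)) ≤ μ.real Up := by linarith
      obtain ⟨V₁, T, hV₁m, hV₁U, hV₁μ, hV₁d, hV₁T, hET⟩ :=
        exists_block_selection hu hM hM0 hC ht hρ hρM hβ hl hlM hlβ (hA k hkL) (hn k hkL)
          (hn' k hkL) hUpm hUpb fun x hx => hx.2
      -- The recursion is applied to each value of `V₁` rather than to each `ε`; hence `W U'`
      -- depends only on the signs of later blocks, and `W (V₁ ε) ε` sees block `k` only through `V₁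
      -- ε`.
      have hall : ∀ U' : Set Ω, U' ∈ Set.range V₁ → _ := fun U' hU' =>
        hih U' (θ - M ^ 2 * (a k * n)) (by obtain ⟨ε, rfl⟩ := hU'; exact hV₁m ε)
          (by
            obtain ⟨ε, rfl⟩ := hU'
            exact lt_of_lt_of_le (mul_pos (by positivity) ((exp_pos _).trans_le hUpb)) (hV₁μ ε))
          (fun h => by
            obtain ⟨ε, rfl⟩ := hU'
            refine (hgrow k h).trans (le_trans ?_ (hV₁μ ε))
            gcongr)
          (fun x hx => by
            obtain ⟨ε, rfl⟩ := hU'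
            have h1 := hθ x (hV₁U ε hx).1
            have h2 := mul_le_mul_of_nonneg_left (hqM x) (ha k)
            linarith)
      choose! W hWm hWU hWμ hWd hWE using hall
      have hr : ∀ ε, V₁ ε ∈ Set.range V₁ := fun ε => ⟨ε, rfl⟩
      refine ⟨fun ε => W (V₁ ε) ε, fun ε => hWm _ (hr ε) ε,
        fun ε => (hWU _ (hr ε) ε).trans ((hV₁U ε).trans Set.inter_subset_left),
        fun ε => hWμ _ (hr ε) ε, fun ε ε' h => ?_, ?_⟩
      · simp only
        rw [hV₁d ε ε' (h k (by simp [hkL]))]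
        exact hWd _ (hr ε') ε ε' fun i hi => h i (hsub i hi)
      · rw [Finset.expect_add_distrib]
        have h1 : a k * (c * n) ≤
            𝔼 ε, a k * ∫ x, signSum u (A k) ε x ∂μ[|W (V₁ ε) ε] := by
          rw [← Finset.mul_expect]
          refine mul_le_mul_of_nonneg_left (hET.trans ?_) (ha k)
          refine Finset.expect_le_expect fun ε _ => ?_
          have hne : μ (W (V₁ ε) ε) ≠ 0 := fun h => by
            have := hWμ _ (hr ε) ε
            simp [measureReal_def, h] at this
          have := cond_isProbabilityMeasure (μ := μ) hne
          have h2 : ∫ _, T ε ∂μ[|W (V₁ ε) ε] ≤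
              ∫ x, signSum u (A k) ε x ∂μ[|W (V₁ ε) ε] := by
            refine integral_mono_ae (integrable_const _)
              (integrable_of_abs_le (measurable_signSum hu _ ε) (abs_signSum_le hM _ ε)) ?_
            filter_upwards [ae_cond_mem (hWm _ (hr ε) ε)] with x hx
            exact hV₁T ε x (hWU _ (hr ε) ε hx)
          simpa using h2
        have h2 : c / M ^ 2 * (θ - M ^ 2 * (a k * n) - ρ * rest) ≤
            𝔼 ε, ∑ i ∈ Finset.Ico (k + 1) L,
              a i * ∫ x, signSum u (A i) ε x ∂μ[|W (V₁ ε) ε] := by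
          -- Freeze the signs on block `k` and average over the rest: the starting set `V₁ ε` is
          -- then fixed and the recursive bound applies.
          rw [← expect_expect_piecewise (A k)]
          refine Finset.le_expect Finset.univ_nonempty fun ε _ => ?_
          refine (hWE _ (hr ε)).trans_eq (Finset.expect_congr rfl fun ε' _ => ?_)
          have e1 : V₁ ((A k).piecewise ε ε') = V₁ ε :=
            hV₁d _ _ fun j hj => Finset.piecewise_eq_of_mem _ _ _ hj
          have e2 : W (V₁ ε) ((A k).piecewise ε ε') = W (V₁ ε) ε' :=
            hWd _ (hr ε) _ _ fun i hi j hj => Finset.piecewise_eq_of_notMem _ _ _ (hdis i hi j hj)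
          rw [e1, e2]
          refine Finset.sum_congr rfl fun i hi => ?_
          congr 2
          ext x
          exact signSum_congr (fun j hj =>
            (Finset.piecewise_eq_of_notMem _ _ _ (hdis i hi j hj)).symm) x
        refine le_trans ?_ (add_le_add h1 h2)
        have h3 : c / M ^ 2 * (M ^ 2 * (a k * n)) = a k * (c * n) := by field_simp
        have h4 : 0 ≤ c / M ^ 2 * (ρ * (a k * n)) := by positivity
        linarith
    · have hUmm : MeasurableSet Um := hUm.diff hqs
      have hUmb : exp (-(β / 2 * n)) ≤ μ.real Um := by linarith
      obtain ⟨V, hVm, hVU, hVμ, hVd, hVE⟩ := hih Um (θ - ρ * (a k * n)) hUmm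
        ((exp_pos _).trans_le hUmb)
        (fun h => by
          refine (hgrow k h).trans (le_trans ?_ hUmb)
          refine mul_le_of_le_one_left (exp_pos _).le ?_
          have : exp (-(2 * (l * (M * n)))) ≤ 1 := exp_le_one_iff.2 (by
            have : 0 ≤ n := by positivity
            have : 0 ≤ 2 * (l * (M * n)) := by positivity
            linarith)
          linarith)
        (fun x hx => by
          have h1 := hθ x hx.1
          have h2 := mul_le_mul_of_nonneg_left (not_le.1 hx.2).le (ha k)
          linarith)
      refine ⟨V, hVm, fun ε => (hVU ε).trans Set.sdiff_subset, hVμ,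
        fun ε ε' h => hVd ε ε' fun i hi => h i (hsub i hi), ?_⟩
      rw [Finset.expect_add_distrib]
      -- For a skipped block `V` ignores the signs in `A k`, so flipping one of them kills its term.
      have h1 : 𝔼 ε, a k * ∫ x, signSum u (A k) ε x ∂μ[|V ε] = 0 := by
        simp_rw [fun ε => integral_signSum (μ[|V ε]) hu hM (A k) ε]
        rw [← Finset.mul_expect, Finset.expect_sum_comm, Finset.sum_eq_zero, mul_zero]
        intro j hj
        refine expect_eq_zero_of_flipSign j _ fun ε => ?_
        rw [sgn_flipSign_self, hVd (flipSign j ε) ε fun i hi j' hj' =>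
          flipSign_apply_of_ne ε fun h => hdis i hi j' hj' (h ▸ hj)]
        ring
      rw [h1, zero_add]
      refine le_trans (le_of_eq ?_) hVE
      ring

end MultiBlock

/-! ### Geometric block sizes -/

section Blocks

open Real

/-- A decreasing sequence of weights is controlled by its values at the ends of geometric blocks. -/
theorem sum_range_pow_le {w : ℕ → ℝ} (hw : Antitone w) {R : ℕ} (hR : 1 ≤ R) (m : ℕ) :
    ∑ i ∈ Finset.range (R ^ (m + 1)), w i ≤
      R * w 0 + R * ∑ k ∈ Finset.range m, w (R ^ (k + 1) - 1) * ((R ^ (k + 1) - R ^ k : ℕ) : ℝ) := by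
  induction m with
  | zero =>
    simp only [zero_add, pow_one, Finset.range_zero, Finset.sum_empty, mul_zero, add_zero]
    exact (Finset.sum_le_card_nsmul _ _ (w 0) fun i _ => hw (Nat.zero_le i)).trans (by simp)
  | succ m ih =>
    have hle : R ^ (m + 1) ≤ R ^ (m + 2) := Nat.pow_le_pow_right hR (by omega)
    rw [Finset.sum_range_succ, mul_add, ← add_assoc, ← Finset.sum_range_add_sum_Ico _ hle]
    refine add_le_add ih ?_
    -- On the new block the weights are at most the weight at the last index of the preceding block,
    -- which is `R` times shorter.
    refine (Finset.sum_le_card_nsmul _ _ (w (R ^ (m + 1) - 1)) fun i hi => hw ?_).trans ?_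
    · have := (Finset.mem_Ico.1 hi).1
      omega
    · rw [Nat.card_Ico, nsmul_eq_mul]
      have : R ^ (m + 2) - R ^ (m + 1) = R * (R ^ (m + 1) - R ^ m) := by
        rw [Nat.mul_sub]; ring_nf
      rw [this]
      push_cast
      exact le_of_eq (by ring)

/-- A choice of the ratio of consecutive block sizes. -/
theorem exists_block_ratio {β κ δ : ℝ} (hβ : 0 < β) (hδ : 0 < δ) :
    ∃ R : ℕ, 2 ≤ R ∧ ∀ n : ℝ, (R : ℝ) - 1 ≤ n →
      2 * exp (-(β / 2 * n)) ≤ δ ∧ κ ≤ n ∧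
      2 * exp (-(β / 2 * (R * n))) ≤ 2⁻¹ * exp (-(β / 2 * n)) * exp (-(β / 2 * n)) := by
  -- The terms `4/(βδ)` and `8/β` serve the first and third claims through `e^x ≥ 1 + x`; in the
  -- third, the exponents differ by `(β/2)(R - 2)n ≥ 4`.
  obtain ⟨R, hR⟩ := exists_nat_ge (4 + |κ| + 4 / (β * δ) + 8 / β)
  have h1 : 0 < 4 / (β * δ) := by positivity
  have h2 : 0 < 8 / β := by positivity
  have h3 := abs_nonneg κ
  have hR2 : (4 : ℝ) ≤ R := by linarith
  refine ⟨R, by exact_mod_cast (by linarith : (2 : ℝ) ≤ R), fun n hn => ⟨?_, ?_, ?_⟩⟩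
  · have h4 : 4 / (β * δ) ≤ n := by linarith
    rw [div_le_iff₀ (by positivity)] at h4
    have h5 := add_one_le_exp (β / 2 * n)
    rw [exp_neg, ← div_eq_mul_inv, div_le_iff₀ (exp_pos _)]
    nlinarith
  · linarith [le_abs_self κ]
  · have h4 : 8 / β ≤ R - 2 := by linarith
    have h5 : 8 ≤ (R - 2) * β := (div_le_iff₀ hβ).1 h4
    have hn1 : 1 ≤ n := by linarith
    have h6 : (4 : ℝ) ≤ exp (β / 2 * ((R - 2) * n)) := by
      have := add_one_le_exp (β / 2 * ((R - 2) * n))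
      nlinarith
    have h7 : exp (-(β / 2 * n)) * exp (-(β / 2 * n)) =
        exp (-(β / 2 * (R * n))) * exp (β / 2 * ((R - 2) * n)) := by
      rw [← exp_add, ← exp_add]; ring_nf
    rw [mul_assoc, h7]
    nlinarith [exp_pos (-(β / 2 * (R * n)))]

end Blocks

/-! ### Mass of a large quadratic sum, and normalized indicators -/

section RandomDensity

open ProbabilityTheory Real
open scoped BigOperators

variable {Ω : Type*} [MeasurableSpace Ω] {μ : Measure Ω} {M C : ℝ}

/-- Reverse Markov: the part of `Q` below `W/4` accounts for at most half of its integral, and above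
it `Q` is at most `M² W`. -/
theorem measureReal_ge_of_integral_ge [IsProbabilityMeasure μ] {Q : Ω → ℝ} {W : ℝ}
    (hQm : Measurable Q) (hW : 0 < W) (hQ0 : ∀ x, 0 ≤ Q x) (hQM : ∀ x, Q x ≤ M ^ 2 * W)
    (hM0 : 0 < M) (hQ : W / 2 ≤ ∫ x, Q x ∂μ) :
    1 / (4 * M ^ 2) ≤ μ.real {x | W / 4 ≤ Q x} := by
  set E : Set Ω := {x | W / 4 ≤ Q x} with hE
  have hEm : MeasurableSet E := measurableSet_le measurable_const hQm
  have h1 : ∫ x, Q x ∂μ ≤ ∫ x, (W / 4 + E.indicator (fun _ => M ^ 2 * W) x) ∂μ := by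
    refine integral_mono (integrable_of_abs_le (b := M ^ 2 * W) hQm fun x => by
        rw [abs_of_nonneg (hQ0 x)]; exact hQM x)
      ((integrable_const _).add ((integrable_const _).indicator hEm)) fun x => ?_
    by_cases hx : x ∈ E
    · simp only [Set.indicator_of_mem hx]; linarith [hQM x]
    · simp only [Set.indicator_of_notMem hx, add_zero]
      exact (not_le.1 hx).le
  have h2 : ∫ x, (W / 4 + E.indicator (fun _ => M ^ 2 * W) x) ∂μ = W / 4 + M ^ 2 * W * μ.real E := by
    rw [integral_add (integrable_const _) ((integrable_const _).indicator hEm),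
      integral_indicator_const _ hEm]
    simp [mul_comm]
  have h3 : W / 4 ≤ M ^ 2 * W * μ.real E := by linarith
  rw [div_le_iff₀ (by positivity)]
  have h4 : W * 1 ≤ W * (μ.real E * (4 * M ^ 2)) := by linarith
  exact le_of_mul_le_mul_left h4 hW

/-- The normalized indicator function of a set. -/
noncomputable def normalizedIndicator (μ : Measure Ω) (V : Set Ω) : Ω → ℂ :=
  V.indicator fun _ => (((μ.real V)⁻¹ : ℝ) : ℂ)

theorem integral_norm_normalizedIndicator_le [IsProbabilityMeasure μ] {V : Set Ω}
    (hV : MeasurableSet V) : ∫ x, ‖normalizedIndicator μ V x‖ ∂μ ≤ 1 := by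
  simp_rw [normalizedIndicator, norm_indicator_eq_indicator_norm]
  rw [integral_indicator_const _ hV]
  simp only [Complex.norm_real, norm_inv, smul_eq_mul, Real.norm_eq_abs,
    abs_of_nonneg (measureReal_nonneg (μ := μ) (s := V))]
  exact mul_inv_le_one

theorem integral_normalizedIndicator_mul {V : Set Ω} (hV : MeasurableSet V) (f : Ω → ℂ) :
    ∫ x, normalizedIndicator μ V x * f x ∂μ = ∫ x, f x ∂μ[|V] := by
  have : ∀ x, normalizedIndicator μ V x * f x =
      V.indicator (fun x => (((μ.real V)⁻¹ : ℝ) : ℂ) * f x) x := fun x => by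
    by_cases h : x ∈ V <;> simp [normalizedIndicator, h]
  simp_rw [this]
  rw [integral_indicator hV, integral_const_mul, ProbabilityTheory.cond, integral_smul_measure]
  simp [measureReal_def]

end RandomDensity

/-! ### Random sets correlating with all blocks -/

section RandomDensity

open ProbabilityTheory Real
open scoped BigOperators

variable {Ω : Type*} [MeasurableSpace Ω] {μ : Measure Ω} {M C : ℝ}

/-- The `k`-th geometric block of indices. -/
def geomBlock (N R k : ℕ) : Finset (Fin N) :=
  Finset.univ.filter fun i => R ^ k ≤ i.val ∧ i.val < R ^ (k + 1)

theorem card_geomBlock {N R k : ℕ} (h : R ^ (k + 1) ≤ N) :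
    (geomBlock N R k).card = R ^ (k + 1) - R ^ k := by
  have : (geomBlock N R k).map Fin.valEmbedding = Finset.Ico (R ^ k) (R ^ (k + 1)) := by
    ext i
    simp only [geomBlock, Finset.mem_map, Finset.mem_filter, Finset.mem_univ, true_and,
      Fin.valEmbedding_apply, Finset.mem_Ico]
    exact ⟨by rintro ⟨j, hj, rfl⟩; exact hj, fun hi => ⟨⟨i, hi.2.trans_le h⟩, hi, rfl⟩⟩
  rw [← Finset.card_map Fin.valEmbedding, this, Nat.card_Ico]

theorem disjoint_geomBlock {N R i k : ℕ} (hR : 1 ≤ R) (h : i < k) :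
    Disjoint (geomBlock N R i) (geomBlock N R k) := by
  rw [Finset.disjoint_left]
  intro j hj hj'
  simp only [geomBlock, Finset.mem_filter, Finset.mem_univ, true_and] at hj hj'
  have : R ^ (i + 1) ≤ R ^ k := Nat.pow_le_pow_right hR h
  omega

/-- Extension of a finite sequence by zero. -/
def extendZero {N : ℕ} (w : Fin N → ℝ) (i : ℕ) : ℝ := if h : i < N then w ⟨i, h⟩ else 0

theorem antitone_extendZero {N : ℕ} {w : Fin N → ℝ} (hw : Antitone w) (h0 : ∀ i, 0 ≤ w i) :
    Antitone (extendZero w) := by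
  intro i j hij
  unfold extendZero
  split_ifs with h1 h2 h2
  · exact hw hij
  · omega
  · exact h0 _
  · exact le_rfl

/-- Only complete blocks appear on the right; an incomplete final one is charged to the block before
it. Index 0 lies in no block, since blocks start at `R ^ 0 = 1`; its weight is in the first term. -/
theorem sum_le_sum_geomBlock {N : ℕ} {w : Fin N → ℝ} (hw : Antitone w) (h0 : ∀ i, 0 ≤ w i)
    {R : ℕ} (hR : 2 ≤ R) (hN : 0 < N) :
    ∑ i, w i ≤ R * w ⟨0, hN⟩ + R * ∑ k ∈ Finset.range (Nat.log R N),
      extendZero w (R ^ (k + 1) - 1) * (geomBlock N R k).card := by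
  have h1 : ∑ i, w i = ∑ i ∈ Finset.range N, extendZero w i := by
    rw [Finset.sum_range]
    exact Finset.sum_congr rfl fun i _ => by simp [extendZero]
  have h2 : ∑ i ∈ Finset.range N, extendZero w i ≤
      ∑ i ∈ Finset.range (R ^ (Nat.log R N + 1)), extendZero w i := by
    refine Finset.sum_le_sum_of_subset_of_nonneg ?_ fun i _ _ => ?_
    · exact Finset.range_subset_range.2 (Nat.lt_pow_succ_log_self (by omega) N).le
    · unfold extendZero
      split_ifs
      · exact h0 _
      · exact le_rfl
  rw [h1]
  refine h2.trans ((sum_range_pow_le (antitone_extendZero hw h0) (by omega) _).trans_eq ?_)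
  congr 1
  · simp [extendZero, hN]
  · congr 1
    refine Finset.sum_congr rfl fun k hk => ?_
    rw [card_geomBlock]
    refine (Nat.pow_le_pow_right (by omega) (Finset.mem_range.1 hk)).trans
      (Nat.pow_log_le_self R hN.ne')

theorem extendZero_le_of_mem_geomBlock {N R k : ℕ} {w : Fin N → ℝ} (hw : Antitone w)
    (h0 : ∀ i, 0 ≤ w i) {j : Fin N} (hj : j ∈ geomBlock N R k) :
    extendZero w (R ^ (k + 1) - 1) ≤ w j := by
  simp only [geomBlock, Finset.mem_filter, Finset.mem_univ, true_and] at hj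
  refine (antitone_extendZero hw h0 (by omega : j.val ≤ R ^ (k + 1) - 1)).trans_eq ?_
  simp [extendZero]

theorem sum_geomBlock_le {N R : ℕ} (hR : 1 ≤ R) {f : Fin N → ℝ} (hf : ∀ i, 0 ≤ f i) (L : ℕ) :
    ∑ k ∈ Finset.range L, ∑ j ∈ geomBlock N R k, f j ≤ ∑ j, f j := by
  rw [← Finset.sum_biUnion]
  · exact Finset.sum_le_sum_of_subset_of_nonneg (Finset.subset_univ _) fun i _ _ => hf i
  · intro i _ k _ hik
    rcases Nat.lt_or_gt_of_ne hik with h | h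
    · exact disjoint_geomBlock hR h
    · exact (disjoint_geomBlock hR h).symm

/-- A random set on which the random signs correlate with a weighted family of functions. -/
theorem exists_random_set (hM : 1 ≤ M) (hC : 1 ≤ C) :
    ∃ R : ℕ, 2 ≤ R ∧ ∃ c : ℝ, 0 < c ∧
      ∀ {Ω : Type*} [MeasurableSpace Ω] (μ : Measure Ω) [IsProbabilityMeasure μ] {N : ℕ}
        (u : Fin N → Ω → ℝ) (a : ℕ → ℝ), 0 < N → (∀ j, Measurable (u j)) →
        (∀ j x, |u j x| ≤ M) → SubgaussianTail μ u C → (∀ k, 0 ≤ a k) →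
        0 < ∑ k ∈ Finset.range (Nat.log R N), a k * (geomBlock N R k).card →
        (∑ k ∈ Finset.range (Nat.log R N), a k * (geomBlock N R k).card) / 2 ≤
          ∑ k ∈ Finset.range (Nat.log R N), a k * ∑ j ∈ geomBlock N R k, ∫ x, u j x ^ 2 ∂μ →
        ∃ V : (Fin N → ℤˣ) → Set Ω, (∀ ε, MeasurableSet (V ε)) ∧ (∀ ε, 0 < μ.real (V ε)) ∧
          c * ∑ k ∈ Finset.range (Nat.log R N), a k * (geomBlock N R k).card ≤
          ∑ k ∈ Finset.range (Nat.log R N), a k * ∑ j ∈ geomBlock N R k,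
            𝔼 ε, sgn ε j * ∫ x, u j x ∂μ[|V ε] := by
  have hM0 : 0 < M := by linarith
  have hC0 : 0 < C := by linarith
  -- On the starting set the weighted quadratic sum is at least `W/4`; with `ρ = 1/8` the skipped
  -- blocks use at most `W/8`, leaving the `W/8` seen in the final constant.
  obtain ⟨ρ, hρd⟩ : ∃ ρ : ℝ, ρ = 1 / 8 := ⟨_, rfl⟩
  have hρ : 0 < ρ := by rw [hρd]; norm_num
  obtain ⟨β, hβ⟩ : ∃ β : ℝ, β = ρ ^ 2 / (32 * C ^ 2 * M ^ 2) := ⟨_, rfl⟩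
  have hβ0 : 0 < β := by rw [hβ]; positivity
  have hβ1 : β ≤ 1 := by
    rw [hβ, div_le_one (by positivity), hρd]
    have h1 : 1 ≤ C ^ 2 := one_le_pow₀ hC
    have h2 : 1 ≤ M ^ 2 := one_le_pow₀ hM
    nlinarith
  -- Chosen so that `2lM = β/2`, the tilt's share of the density budget.
  obtain ⟨l, hld⟩ : ∃ l : ℝ, l = β / (4 * M) := ⟨_, rfl⟩
  have hl : 0 < l := by rw [hld]; positivity
  have hlM' : l * M = β / 4 := by rw [hld]; field_simp
  have hρM : ρ ≤ M ^ 2 := by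
    have h2 : 1 ≤ M ^ 2 := one_le_pow₀ hM
    rw [hρd]; linarith
  obtain ⟨c, hc⟩ : ∃ c : ℝ, c = l * ρ ^ 2 / (256 * M ^ 2) := ⟨_, rfl⟩
  have hc0 : 0 < c := by rw [hc]; positivity
  have hδ1 : 0 < ρ / (16 * M ^ 2) := by positivity
  have hδ2 : 0 < 1 / (4 * M ^ 2) := by positivity
  obtain ⟨R, hR2, hR⟩ := exists_block_ratio (κ := log 2 / l / c) hβ0 (lt_min hδ1 hδ2)
  refine ⟨R, hR2, c / M ^ 2 / 8, by positivity, ?_⟩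
  intro Ω _ μ _ N u a hN hu hMu ht ha hW hWu
  set L := Nat.log R N with hL
  set A : ℕ → Finset (Fin N) := geomBlock N R with hA
  set W := ∑ k ∈ Finset.range L, a k * (A k).card with hWd
  have hR1 : (1 : ℝ) ≤ R := by exact_mod_cast (by omega : 1 ≤ R)
  have hfull : ∀ k < L, R ^ (k + 1) ≤ N := fun k hk =>
    (Nat.pow_le_pow_right (by omega) hk).trans (Nat.pow_log_le_self R hN.ne')
  have hcard : ∀ k < L, ((A k).card : ℝ) = (R : ℝ) ^ k * (R - 1) := fun k hk => by
    rw [hA, card_geomBlock (hfull k hk), Nat.cast_sub (Nat.pow_le_pow_right (by omega) (by omega))]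
    push_cast
    ring
  have hcardR : ∀ k < L, (R : ℝ) - 1 ≤ (A k).card := fun k hk => by
    rw [hcard k hk]
    exact le_mul_of_one_le_left (by linarith) (one_le_pow₀ hR1)
  have hcardS : ∀ k, k + 1 < L → ((A (k + 1)).card : ℝ) = R * (A k).card := fun k hk => by
    rw [hcard _ hk, hcard _ (by omega)]; ring
  set Q : Ω → ℝ := fun x => ∑ k ∈ Finset.range L, a k * ∑ j ∈ A k, u j x ^ 2 with hQ
  have hQm : Measurable Q := Finset.measurable_sum _ fun k _ =>
    (Finset.measurable_sum _ fun j _ => (hu j).pow_const 2).const_mul _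
  have hsq : ∀ j x, u j x ^ 2 ≤ M ^ 2 := fun j x => by
    rw [← sq_abs]; exact pow_le_pow_left₀ (abs_nonneg _) (hMu j x) 2
  have hint : ∀ j, Integrable (fun x => u j x ^ 2) μ := fun j =>
    integrable_of_abs_le (b := M ^ 2) ((hu j).pow_const 2) fun x => by
      rw [abs_of_nonneg (sq_nonneg _)]
      exact hsq j x
  have hQi : ∫ x, Q x ∂μ = ∑ k ∈ Finset.range L, a k * ∑ j ∈ A k, ∫ x, u j x ^ 2 ∂μ := by
    rw [hQ, integral_finsetSum _ fun k _ => (integrable_finsetSum _ fun j _ => hint j).const_mul _]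
    refine Finset.sum_congr rfl fun k _ => ?_
    rw [integral_const_mul, integral_finsetSum _ fun j _ => hint j]
  have hmass := measureReal_ge_of_integral_ge (μ := μ) (M := M) hQm hW
    (fun x => Finset.sum_nonneg fun k _ =>
      mul_nonneg (ha k) (Finset.sum_nonneg fun j _ => sq_nonneg _))
    (fun x => by
      rw [hWd, Finset.mul_sum]
      refine Finset.sum_le_sum fun k _ => ?_
      have := Finset.sum_le_card_nsmul (A k) (fun j => u j x ^ 2) _ fun j _ => hsq j x
      rw [nsmul_eq_mul] at this
      nlinarith [mul_le_mul_of_nonneg_left this (ha k)])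
    hM0 (hQi ▸ hWu)
  set U : Set Ω := {x | W / 4 ≤ Q x} with hU
  have hlMn : ∀ n : ℝ, 2 * (l * (M * n)) = β / 2 * n := fun n => by
    rw [← mul_assoc l, hlM']; ring
  obtain ⟨V, hVm, -, hV0, -, hV⟩ := exists_multiblock_selection (μ := μ) hu hMu hM0 hC0 ht hρ hρM
    hβ hl (by linarith) (by linarith) (A := A) (L := L) ha
    (fun i k h => disjoint_geomBlock (by omega) h)
    (fun k hk => by
      have h1 := hcardR k hk
      have h2 : (2 : ℝ) ≤ R := by exact_mod_cast hR2
      exact_mod_cast (by linarith : (0 : ℝ) < (A k).card))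
    (fun k hk => by
      have h1 := (hR _ (hcardR k hk)).1.trans (min_le_left _ _)
      refine le_trans ?_ h1
      have h2 : exp (-(β * (A k).card)) ≤ exp (-(β / 2 * (A k).card)) := by
        apply exp_le_exp.2
        have : 0 ≤ β * (A k).card := by positivity
        linarith
      linarith [exp_pos (-(β / 2 * (A k).card))])
    (fun k hk => by
      have h1 := (hR _ (hcardR k hk)).2.1
      rw [← hc, mul_comm]
      exact (div_le_iff₀ hc0).1 h1)
    (fun k hk => by
      rw [hcardS k hk, hlMn]
      exact (hR _ (hcardR k (by omega))).2.2)
    L 0 (zero_add L) U (W / 4) (measurableSet_le measurable_const hQm) (hδ2.trans_le hmass)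
    (fun h => ((hR _ (hcardR 0 h)).1.trans (min_le_right _ _)).trans hmass)
    (fun x hx => by rw [← Finset.range_eq_Ico]; exact hx)
  refine ⟨V, hVm, hV0, ?_⟩
  rw [← Finset.range_eq_Ico, ← hWd, ← hc, hρd] at hV
  refine le_trans (le_of_eq (by ring)) (hV.trans_eq ?_)
  rw [Finset.expect_sum_comm]
  refine Finset.sum_congr rfl fun k _ => ?_
  rw [← Finset.mul_expect, ← Finset.expect_sum_comm]
  simp_rw [fun ε => integral_signSum (μ[|V ε]) hu hMu (A k) ε]

end RandomDensity

/-! ### Random densities for complex systems -/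

section RandomDensityComplex

open ProbabilityTheory Real
open scoped BigOperators

theorem re_expect {α : Type*} [Fintype α] (f : α → ℂ) : (𝔼 i, f i).re = 𝔼 i, (f i).re := by
  simp

/-- Random densities of norm one, correlating with a weighted family of functions. -/
theorem exists_random_density {M C : ℝ} (hM : 1 ≤ M) (hC : 1 ≤ C) :
    ∃ c : ℝ, 0 < c ∧ c ≤ 1 ∧
      ∀ {Ω : Type*} [MeasurableSpace Ω] (μ : Measure Ω) [IsProbabilityMeasure μ] {N : ℕ}
        (φ : Fin N → Ω → ℂ) (w : Fin N → ℝ), (∀ j, Measurable (φ j)) →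
        (∀ j x, ‖φ j x‖ ≤ M) → (∀ j, ∫ x, ‖φ j x‖ ^ 2 ∂μ = 1) →
        (∀ ζ : ℂ, ‖ζ‖ = 1 → SubgaussianTail μ (fun j x => (ζ * φ j x).re) C) →
        Antitone w → (∀ j, 0 ≤ w j) → ∑ j, w j = 1 →
        ∃ ν : (Fin N → ℤˣ) → Ω → ℂ, (∀ ε, Integrable (ν ε) μ) ∧
          (∀ ε, ∫ x, ‖ν ε x‖ ∂μ ≤ 1) ∧
          c ≤ ∑ j, w j * ‖𝔼 ε, (sgn ε j : ℂ) * ∫ x, ν ε x * φ j x ∂μ‖ := by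
  obtain ⟨R, hR2, c, hc, H⟩ := exists_random_set hM hC
  have hR0 : (0 : ℝ) < R := by exact_mod_cast (by omega : 0 < R)
  refine ⟨min 1 (min (1 / (2 * R)) (c / (2 * R))), lt_min one_pos (lt_min (by positivity)
    (by positivity)), min_le_left _ _, ?_⟩
  intro Ω _ μ _ N φ w hφ hφM hφ1 ht hw hw0 hw1
  have hN : 0 < N := by
    rcases Nat.eq_zero_or_pos N with rfl | h
    · simp at hw1
    · exact h
  have hφi : ∀ j, Integrable (φ j) μ := fun j =>
    Integrable.of_bound (hφ j).aestronglyMeasurable M (Filter.Eventually.of_forall (hφM j))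
  have hφsq : ∀ j, Integrable (fun x => ‖φ j x‖ ^ 2) μ := fun j =>
    integrable_of_abs_le (b := M ^ 2) ((hφ j).norm.pow_const 2) fun x => by
      rw [abs_of_nonneg (sq_nonneg _)]
      exact pow_le_pow_left₀ (norm_nonneg _) (hφM j x) 2
  -- A heavy first weight is handled by index 0 alone, with density `ε_0 conj φ_0`, whose
  -- correlation with `φ_0` is 1. Otherwise the first term of the block bound is at most `1/2`, and
  -- the blocks carry the rest.
  by_cases hcase : 1 / (2 * R) ≤ w ⟨0, hN⟩
  · set z : Fin N := ⟨0, hN⟩ with hz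
    refine ⟨fun ε x => (sgn ε z : ℂ) * starRingEnd ℂ (φ z x), fun ε => ?_, fun ε => ?_, ?_⟩
    · refine Integrable.const_mul ?_ _
      exact Integrable.of_bound
        (Complex.continuous_conj.measurable.comp (hφ z)).aestronglyMeasurable M
        (Filter.Eventually.of_forall fun x => by simpa using hφM z x)
    · have h1 : ∫ x, ‖φ z x‖ ∂μ ≤ ∫ x, (1 + ‖φ z x‖ ^ 2) / 2 ∂μ := by
        refine integral_mono (hφi z).norm (((integrable_const _).add (hφsq z)).div_const _)
          fun x => ?_
        simp only
        nlinarith [sq_nonneg (‖φ z x‖ - 1)]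
      have h2 : ∫ x, (1 + ‖φ z x‖ ^ 2) / 2 ∂μ = 1 := by
        rw [integral_div, integral_add (integrable_const _) (hφsq z), hφ1]
        simp
      have h3 : ∀ x, ‖(sgn ε z : ℂ) * starRingEnd ℂ (φ z x)‖ = ‖φ z x‖ := fun x => by
        rw [norm_mul, Complex.norm_real, Real.norm_eq_abs, abs_sgn, RCLike.norm_conj, one_mul]
      simp_rw [h3]
      linarith
    · have h1 : ∀ ε : Fin N → ℤˣ, (sgn ε z : ℂ) *
          ∫ x, (sgn ε z : ℂ) * starRingEnd ℂ (φ z x) * φ z x ∂μ = 1 := fun ε => by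
        have e1 : ∀ x, (sgn ε z : ℂ) * starRingEnd ℂ (φ z x) * φ z x =
            (sgn ε z : ℂ) * ((‖φ z x‖ ^ 2 : ℝ) : ℂ) := fun x => by
          rw [mul_assoc, Complex.conj_mul']; push_cast; ring
        simp_rw [e1]
        rw [integral_const_mul, integral_complex_ofReal, hφ1, ← mul_assoc, ← Complex.ofReal_mul,
          sgn_mul_self]
        simp
      refine le_trans ?_ (Finset.single_le_sum (f := fun j => w j * ‖𝔼 ε : Fin N → ℤˣ,
        (sgn ε j : ℂ) * ∫ x, (sgn ε z : ℂ) * starRingEnd ℂ (φ z x) * φ j x ∂μ‖)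
        (fun j _ => mul_nonneg (hw0 j) (norm_nonneg _)) (Finset.mem_univ z))
      simp only [h1]
      simp only [Fintype.expect_one, norm_one, mul_one]
      exact (min_le_right _ _).trans ((min_le_left _ _).trans hcase)
  · have hsum := sum_le_sum_geomBlock hw hw0 hR2 hN
    -- The weight at the last index of block `k`, hence a lower bound for `w` on that block.
    set a : ℕ → ℝ := fun k => extendZero w (R ^ (k + 1) - 1) with ha
    set W := ∑ k ∈ Finset.range (Nat.log R N), a k * (geomBlock N R k).card with hW
    have hW1 : 1 / (2 * R) ≤ W := by
      rw [hw1] at hsum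
      have h1 : (R : ℝ) * w ⟨0, hN⟩ ≤ 1 / 2 := by
        calc (R : ℝ) * w ⟨0, hN⟩ ≤ R * (1 / (2 * R)) := by
              gcongr; exact (not_le.1 hcase).le
          _ = 1 / 2 := by field_simp
      rw [div_le_iff₀ (by positivity)]
      linarith
    have hW0 : 0 < W := lt_of_lt_of_le (by positivity) hW1
    have ha0 : ∀ k, 0 ≤ a k := fun k => by
      simp only [ha, extendZero]
      split_ifs
      · exact hw0 _
      · exact le_rfl
    -- Since `Re (φ)² + Re (iφ)² = |φ|²` has integral 1, one of `ζ = 1` and `ζ = i` carries half of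
    -- the weighted second moments.
    obtain ⟨ζ, hζ, hζW⟩ : ∃ ζ : ℂ, ‖ζ‖ = 1 ∧ W / 2 ≤ ∑ k ∈ Finset.range (Nat.log R N),
        a k * ∑ j ∈ geomBlock N R k, ∫ x, (ζ * φ j x).re ^ 2 ∂μ := by
      have hsplit : W = (∑ k ∈ Finset.range (Nat.log R N),
          a k * ∑ j ∈ geomBlock N R k, ∫ x, (1 * φ j x).re ^ 2 ∂μ) +
          ∑ k ∈ Finset.range (Nat.log R N),
          a k * ∑ j ∈ geomBlock N R k, ∫ x, (Complex.I * φ j x).re ^ 2 ∂μ := by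
        rw [hW, ← Finset.sum_add_distrib]
        refine Finset.sum_congr rfl fun k _ => ?_
        rw [← mul_add, ← Finset.sum_add_distrib, Finset.card_eq_sum_ones, Nat.cast_sum]
        congr 1
        refine Finset.sum_congr rfl fun j _ => ?_
        have hi : ∀ ζ : ℂ, ‖ζ‖ = 1 → Integrable (fun x => (ζ * φ j x).re ^ 2) μ := fun ζ hζ =>
          integrable_of_abs_le (b := M ^ 2)
            ((Complex.measurable_re.comp ((hφ j).const_mul ζ)).pow_const 2) fun x => by
              rw [abs_of_nonneg (sq_nonneg _), ← sq_abs]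
              refine pow_le_pow_left₀ (abs_nonneg _) ((Complex.abs_re_le_norm _).trans ?_) 2
              rw [norm_mul, hζ, one_mul]
              exact hφM j x
        rw [← integral_add (hi 1 (by simp)) (hi Complex.I (by simp)), Nat.cast_one, ← hφ1 j]
        refine integral_congr_ae (Filter.Eventually.of_forall fun x => ?_)
        simp only [one_mul, Complex.mul_re, Complex.I_re, Complex.I_im, zero_mul, zero_sub,
          Complex.sq_norm, Complex.normSq_apply]
        ring
      by_cases h : W / 2 ≤ ∑ k ∈ Finset.range (Nat.log R N),
          a k * ∑ j ∈ geomBlock N R k, ∫ x, (1 * φ j x).re ^ 2 ∂μ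
      · exact ⟨1, by simp, h⟩
      · exact ⟨Complex.I, by simp, by linarith⟩
    obtain ⟨V, hVm, hV0, hV⟩ := H μ (fun j x => (ζ * φ j x).re) a hN
      (fun j => Complex.measurable_re.comp ((hφ j).const_mul ζ))
      (fun j x => (Complex.abs_re_le_norm _).trans (by rw [norm_mul, hζ, one_mul]; exact hφM j x))
      (ht ζ hζ) ha0 hW0 hζW
    refine ⟨fun ε => normalizedIndicator μ (V ε),
      fun ε => (integrable_const _).indicator (hVm ε),
      fun ε => integral_norm_normalizedIndicator_le (hVm ε), ?_⟩
    have hb : ∀ j, 𝔼 ε, sgn ε j * ∫ x, (ζ * φ j x).re ∂μ[|V ε] ≤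
        ‖𝔼 ε, (sgn ε j : ℂ) * ∫ x, normalizedIndicator μ (V ε) x * φ j x ∂μ‖ := fun j => by
      have e1 : 𝔼 ε, sgn ε j * ∫ x, (ζ * φ j x).re ∂μ[|V ε] =
          (ζ * 𝔼 ε, (sgn ε j : ℂ) * ∫ x, normalizedIndicator μ (V ε) x * φ j x ∂μ).re := by
        rw [Finset.mul_expect, re_expect]
        refine Finset.expect_congr rfl fun ε _ => ?_
        have hne : μ (V ε) ≠ 0 := fun h => by
          have := hV0 ε
          simp [measureReal_def, h] at this
        have := cond_isProbabilityMeasure (μ := μ) hne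
        have hi : Integrable (φ j) (μ[|V ε]) :=
          Integrable.of_bound (hφ j).aestronglyMeasurable M (Filter.Eventually.of_forall (hφM j))
        rw [integral_normalizedIndicator_mul (hVm ε), mul_left_comm, Complex.re_ofReal_mul]
        congr 1
        have e := integral_re (hi.const_mul ζ)
        rw [integral_const_mul] at e
        exact e
      rw [e1]
      refine (Complex.re_le_norm _).trans ?_
      rw [norm_mul, hζ, one_mul]
    refine (min_le_right _ _).trans ((min_le_right _ _).trans ?_)
    calc c / (2 * R) = c * (1 / (2 * R)) := by ring
      _ ≤ c * W := by gcongr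
      _ ≤ _ := hV
      _ ≤ ∑ k ∈ Finset.range (Nat.log R N), ∑ j ∈ geomBlock N R k,
          w j * ‖𝔼 ε, (sgn ε j : ℂ) * ∫ x, normalizedIndicator μ (V ε) x * φ j x ∂μ‖ := by
        refine Finset.sum_le_sum fun k _ => ?_
        rw [Finset.mul_sum]
        refine Finset.sum_le_sum fun j hj => ?_
        exact (mul_le_mul_of_nonneg_left (hb j) (ha0 k)).trans
          (mul_le_mul_of_nonneg_right (extendZero_le_of_mem_geomBlock hw hw0 hj) (norm_nonneg _))
      _ ≤ _ := sum_geomBlock_le (by omega)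
        (fun j => mul_nonneg (hw0 j) (norm_nonneg _)) _

end RandomDensityComplex

/-! ### Riesz products and complex-linear kernels -/

section RieszKernel

open scoped BigOperators

variable {ι : Type*}

theorem sgn_prod {κ : Type*} [Fintype κ] (p : κ → ι → ℤˣ) (j : ι) :
    sgn (∏ i, p i) j = ∏ i, sgn (p i) j := by
  simp [sgn, Finset.prod_apply]

theorem walsh_prod {κ : Type*} [Fintype κ] (p : κ → ι → ℤˣ) (S : Finset ι) :
    walsh S (∏ i, p i) = ∏ i, walsh S (p i) := by
  simp only [walsh, sgn_prod]
  exact Finset.prod_comm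

theorem abs_walsh (S : Finset ι) (ε : ι → ℤˣ) : |walsh S ε| = 1 := by
  simp [walsh, Finset.abs_prod, abs_sgn]

variable [Fintype ι]

/-- The Riesz product with coefficients `θ`. -/
def rieszProduct (θ : ι → ℝ) (η : ι → ℤˣ) : ℝ := ∏ j, (1 + θ j * sgn η j)

theorem rieszProduct_nonneg {θ : ι → ℝ} (hθ : ∀ j, |θ j| ≤ 1) (η : ι → ℤˣ) :
    0 ≤ rieszProduct θ η := by
  refine Finset.prod_nonneg fun j _ => ?_
  have h : |θ j * sgn η j| ≤ 1 := by rw [abs_mul, abs_sgn, mul_one]; exact hθ j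
  linarith [(abs_le.1 h).1]

variable [DecidableEq ι]

omit [DecidableEq ι] in
theorem rieszProduct_eq_sum (θ : ι → ℝ) (η : ι → ℤˣ) :
    rieszProduct θ η = ∑ S : Finset ι, (∏ j ∈ S, θ j) * walsh S η := by
  rw [rieszProduct, Finset.prod_one_add, Finset.powerset_univ]
  exact Finset.sum_congr rfl fun S _ => Finset.prod_mul_distrib

theorem expect_walsh (S : Finset ι) : 𝔼 ε, walsh S ε = if S = ∅ then 1 else 0 := by
  simpa [walsh] using expect_walsh_mul_walsh S ∅

theorem expect_prod_eq_pow {α K : Type*} [Fintype α] [Field K] [CharZero K] (n : ℕ) (f : α → K) :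
    𝔼 p : Fin n → α, ∏ i, f (p i) = (𝔼 a, f a) ^ n := by
  rw [Finset.expect_pow]
  simp

/-- Nonempty Walsh functions have mean zero in each independent factor, so only the constant term
survives; at least one factor is needed. -/
theorem expect_rieszProduct_prod (θ : ι → ℝ) (n : ℕ) (hn : n ≠ 0) :
    𝔼 p : Fin n → ι → ℤˣ, rieszProduct θ (∏ i, p i) = 1 := by
  simp_rw [rieszProduct_eq_sum, walsh_prod]
  rw [Finset.expect_sum_comm]
  simp_rw [← Finset.mul_expect, expect_prod_eq_pow, expect_walsh]
  rw [Finset.sum_eq_single ∅]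
  · simp
  · intro S _ hS
    simp [hS, hn]
  · simp

/-- A combination of two Riesz products whose linear part is complex linear in `z`. -/
noncomputable def rieszKernel (δ : ℝ) (z : ι → ℂ) (η : ι → ℤˣ) : ℂ :=
  ((rieszProduct (fun j => δ * (z j).re) η - 1 : ℝ) : ℂ) / 2 +
    Complex.I / 2 * ((1 - rieszProduct (fun j => -(δ * (z j).im)) η : ℝ) : ℂ)

/-- The Walsh coefficients of `rieszKernel`. -/
noncomputable def rieszCoeff (δ : ℝ) (z : ι → ℂ) (S : Finset ι) : ℂ :=
  if S = ∅ then 0 else ((∏ j ∈ S, δ * (z j).re : ℝ) : ℂ) / 2 -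
    Complex.I / 2 * ((∏ j ∈ S, -(δ * (z j).im) : ℝ) : ℂ)

theorem rieszKernel_eq_sum (δ : ℝ) (z : ι → ℂ) (η : ι → ℤˣ) :
    rieszKernel δ z η = ∑ S : Finset ι, rieszCoeff δ z S * (walsh S η : ℂ) := by
  have h : ∀ θ : ι → ℝ, rieszProduct θ η - 1 =
      ∑ S : Finset ι, if S = ∅ then 0 else (∏ j ∈ S, θ j) * walsh S η := fun θ => by
    rw [rieszProduct_eq_sum, ← Finset.add_sum_erase _ _ (Finset.mem_univ (∅ : Finset ι)),
      ← Finset.add_sum_erase _ (fun S : Finset ι => if S = ∅ then 0 else _)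
        (Finset.mem_univ (∅ : Finset ι))]
    simp only [Finset.prod_empty, walsh, mul_one, if_true, zero_add, add_sub_cancel_left]
    exact Finset.sum_congr rfl fun S hS => by simp [Finset.ne_of_mem_erase hS]
  rw [rieszKernel, ← neg_sub (rieszProduct _ _) (1 : ℝ), h, h, Complex.ofReal_neg,
    Complex.ofReal_sum, Complex.ofReal_sum, Finset.sum_div, mul_neg, Finset.mul_sum,
    ← sub_eq_add_neg, ← Finset.sum_sub_distrib]
  refine Finset.sum_congr rfl fun S _ => ?_
  rw [rieszCoeff]
  split_ifs
  · simp
  · push_cast; ring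

omit [Fintype ι] in
theorem rieszCoeff_singleton (δ : ℝ) (z : ι → ℂ) (j : ι) :
    rieszCoeff δ z {j} = δ / 2 * z j := by
  rw [rieszCoeff, if_neg (Finset.singleton_ne_empty j), Finset.prod_singleton,
    Finset.prod_singleton]
  conv_rhs => rw [← Complex.re_add_im (z j)]
  push_cast
  ring

omit [Fintype ι] in
theorem norm_rieszCoeff_le {δ M : ℝ} (hδ : 0 ≤ δ) (hM : 0 ≤ M) (hδM : δ * M ≤ 1) {z : ι → ℂ}
    (hz : ∀ j, ‖z j‖ ≤ M) {S : Finset ι} {n : ℕ} (hS : n ≤ S.card) :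
    ‖rieszCoeff δ z S‖ ≤ (δ * M) ^ n := by
  have h0 : 0 ≤ δ * M := mul_nonneg hδ hM
  have h : ∀ θ : ι → ℝ, (∀ j, |θ j| ≤ δ * M) → ‖((∏ j ∈ S, θ j : ℝ) : ℂ)‖ ≤ (δ * M) ^ n := by
    intro θ hθ
    rw [Complex.norm_real, Real.norm_eq_abs, Finset.abs_prod]
    calc ∏ j ∈ S, |θ j| ≤ ∏ _j ∈ S, δ * M :=
          Finset.prod_le_prod (fun _ _ => abs_nonneg _) fun j _ => hθ j
      _ = (δ * M) ^ S.card := by rw [Finset.prod_const]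
      _ ≤ _ := pow_le_pow_of_le_one h0 hδM hS
  rw [rieszCoeff]
  split_ifs
  · simpa using pow_nonneg h0 n
  · have h1 := h (fun j => δ * (z j).re) fun j => by
      rw [abs_mul, abs_of_nonneg hδ]
      exact mul_le_mul_of_nonneg_left ((Complex.abs_re_le_norm _).trans (hz j)) hδ
    have h2 := h (fun j => -(δ * (z j).im)) fun j => by
      rw [abs_neg, abs_mul, abs_of_nonneg hδ]
      exact mul_le_mul_of_nonneg_left ((Complex.abs_im_le_norm _).trans (hz j)) hδ
    refine (norm_sub_le _ _).trans ?_
    rw [norm_div, norm_mul, norm_div, Complex.norm_I, Complex.norm_two]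
    linarith

omit [DecidableEq ι] in
theorem norm_rieszKernel_le {δ M : ℝ} (hδ : 0 ≤ δ) (hδM : δ * M ≤ 1) {z : ι → ℂ}
    (hz : ∀ j, ‖z j‖ ≤ M) (η : ι → ℤˣ) :
    ‖rieszKernel δ z η‖ ≤ 1 + (rieszProduct (fun j => δ * (z j).re) η +
      rieszProduct (fun j => -(δ * (z j).im)) η) / 2 := by
  have h1 : 0 ≤ rieszProduct (fun j => δ * (z j).re) η := rieszProduct_nonneg (fun j => by
    rw [abs_mul, abs_of_nonneg hδ]
    exact (mul_le_mul_of_nonneg_left ((Complex.abs_re_le_norm _).trans (hz j)) hδ).trans hδM) η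
  have h2 : 0 ≤ rieszProduct (fun j => -(δ * (z j).im)) η := rieszProduct_nonneg (fun j => by
    rw [abs_neg, abs_mul, abs_of_nonneg hδ]
    exact (mul_le_mul_of_nonneg_left ((Complex.abs_im_le_norm _).trans (hz j)) hδ).trans hδM) η
  rw [rieszKernel]
  refine (norm_add_le _ _).trans ?_
  rw [norm_div, norm_mul, norm_div, Complex.norm_I, Complex.norm_two, Complex.norm_real,
    Complex.norm_real, Real.norm_eq_abs, Real.norm_eq_abs]
  have h3 : |rieszProduct (fun j => δ * (z j).re) η - 1| ≤
      rieszProduct (fun j => δ * (z j).re) η + 1 := abs_le.2 ⟨by linarith, by linarith⟩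
  have h4 : |1 - rieszProduct (fun j => -(δ * (z j).im)) η| ≤
      rieszProduct (fun j => -(δ * (z j).im)) η + 1 := abs_le.2 ⟨by linarith, by linarith⟩
  linarith

/-- Both Riesz products are nonnegative with mean one, so the bound is `1 + (1 + 1)/2`, whatever the
number of indices. -/
theorem expect_norm_rieszKernel_le {δ M : ℝ} (hδ : 0 ≤ δ) (hδM : δ * M ≤ 1) {z : ι → ℂ}
    (hz : ∀ j, ‖z j‖ ≤ M) {n : ℕ} (hn : n ≠ 0) :
    𝔼 p : Fin n → ι → ℤˣ, ‖rieszKernel δ z (∏ i, p i)‖ ≤ 2 := by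
  refine (Finset.expect_le_expect fun p _ => norm_rieszKernel_le hδ hδM hz (∏ i, p i)).trans ?_
  rw [Finset.expect_add_distrib, ← Finset.expect_div, Finset.expect_add_distrib,
    expect_rieszProduct_prod _ n hn, expect_rieszProduct_prod _ n hn]
  simp
  norm_num

end RieszKernel

/-! ### The interpolating function on the five-fold product -/

section TensorDensity

open scoped BigOperators

variable {Ω ι : Type*} [MeasurableSpace Ω]

theorem integral_expect {α K : Type*} [Fintype α] [RCLike K] {μ : Measure Ω} {f : α → Ω → K}
    (hf : ∀ i, Integrable (f i) μ) : ∫ x, 𝔼 i, f i x ∂μ = 𝔼 i, ∫ x, f i x ∂μ := by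
  simp_rw [Fintype.expect_eq_sum_div_card]
  rw [integral_div, integral_finsetSum _ fun i _ => hf i]

theorem integrable_expect {α K : Type*} [Fintype α] [RCLike K] {μ : Measure Ω} {f : α → Ω → K}
    (hf : ∀ i, Integrable (f i) μ) : Integrable (fun x => 𝔼 i, f i x) μ := by
  simp_rw [Fintype.expect_eq_sum_div_card]
  exact (integrable_finsetSum _ fun i _ => hf i).div_const _

theorem norm_expect_le {α : Type*} [Fintype α] (f : α → ℂ) : ‖𝔼 i, f i‖ ≤ 𝔼 i, ‖f i‖ := by
  simp_rw [Fintype.expect_eq_sum_div_card]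
  rw [norm_div, Complex.norm_natCast]
  exact div_le_div_of_nonneg_right (norm_sum_le _ _) (Nat.cast_nonneg _)

variable [Fintype ι] [DecidableEq ι]

/-- An integrable function on the product space that almost interpolates prescribed phases on the
tensor system, built from random densities `ν` and a Riesz product. -/
theorem exists_interpolating_density {μ : Measure Ω} [IsProbabilityMeasure μ] {M δ : ℝ}
    (hM : 1 ≤ M) (hδ : 0 ≤ δ) (hδM : δ * M ≤ 1) {φ : ι → Ω → ℂ} (hφ : ∀ j, Measurable (φ j))
    (hφM : ∀ j x, ‖φ j x‖ ≤ M)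
    (hφo : ∀ j k, ∫ x, starRingEnd ℂ (φ j x) * φ k x ∂μ = if j = k then 1 else 0)
    {ν : (ι → ℤˣ) → Ω → ℂ} (hνi : ∀ ε, Integrable (ν ε) μ)
    (hν : ∀ ε, ∫ x, ‖ν ε x‖ ∂μ ≤ 1) (s : ι → ℂ) (hs : ∀ j, ‖s j‖ ≤ 1) :
    ∃ F : (Fin 5 → Ω) → ℂ, Integrable F (Measure.pi fun _ => μ) ∧
      ∫ x, ‖F x‖ ∂(Measure.pi fun _ => μ) ≤ 2 ∧
      ∀ k, ‖∫ x, F x * tensorSystem 5 φ k x ∂(Measure.pi fun _ => μ) -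
        δ / 2 * s k * (𝔼 ε, (sgn ε k : ℂ) * ∫ x, ν ε x * φ k x ∂μ) ^ 4‖ ≤ δ ^ 2 * M ^ 7 := by
  have hM0 : 0 ≤ M := by linarith
  set z : Ω → ι → ℂ := fun x j => s j * starRingEnd ℂ (φ j x) with hz
  have hzM : ∀ x j, ‖z x j‖ ≤ M := fun x j => by
    rw [hz, norm_mul, RCLike.norm_conj]
    exact (mul_le_of_le_one_left (norm_nonneg _) (hs j)).trans (hφM j x)
  have hzm : ∀ j, Measurable fun x => z x j := fun j =>
    (Complex.continuous_conj.measurable.comp (hφ j)).const_mul _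
  have hCm : ∀ S, Measurable fun x => rieszCoeff δ (z x) S := fun S => by
    unfold rieszCoeff
    split_ifs
    · exact measurable_const
    · refine Measurable.sub (Measurable.div_const (Complex.measurable_ofReal.comp
        (Finset.measurable_prod _ fun j _ => ?_)) _) (Measurable.const_mul
          (Complex.measurable_ofReal.comp (Finset.measurable_prod _ fun j _ => ?_)) _)
      · exact (Complex.measurable_re.comp (hzm j)).const_mul δ
      · exact ((Complex.measurable_im.comp (hzm j)).const_mul δ).neg
  have hCi : ∀ S, Integrable (fun x => rieszCoeff δ (z x) S) μ := fun S =>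
    Integrable.of_bound (hCm S).aestronglyMeasurable 1 (Filter.Eventually.of_forall fun x => by
      simpa using norm_rieszCoeff_le hδ hM0 hδM (hzM x) (Nat.zero_le S.card))
  have hKe : ∀ η x, rieszKernel δ (z x) η = ∑ S, rieszCoeff δ (z x) S * (walsh S η : ℂ) :=
    fun η x => rieszKernel_eq_sum δ (z x) η
  have hKi : ∀ η, Integrable (fun x => rieszKernel δ (z x) η) μ := fun η => by
    simp_rw [hKe]
    exact integrable_finsetSum _ fun S _ => (hCi S).mul_const _
  -- Four variables carry the random densities and the last carries the kernel evaluated at the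
  -- product of the four sign vectors; since `walsh S` is multiplicative, averaging produces fourth
  -- powers.
  set f : (Fin 4 → ι → ℤˣ) → Fin 5 → Ω → ℂ := fun p =>
    Fin.snoc (α := fun _ => Ω → ℂ) (fun i => ν (p i)) fun x => rieszKernel δ (z x) (∏ i, p i)
    with hf
  have hfc : ∀ p (i : Fin 4), f p i.castSucc = ν (p i) := fun p i => by
    simp only [hf]
    exact Fin.snoc_castSucc (α := fun _ => Ω → ℂ) _ _ i
  have hfl : ∀ p, f p (Fin.last 4) = fun x => rieszKernel δ (z x) (∏ i, p i) := fun p => by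
    simp only [hf]
    exact Fin.snoc_last (α := fun _ => Ω → ℂ) _ _
  have hfi : ∀ p i, Integrable (f p i) μ := fun p i => by
    refine Fin.lastCases ?_ (fun i => ?_) i
    · rw [hfl]; exact hKi _
    · rw [hfc]; exact hνi _
  have hpi : ∀ p, Integrable (fun x : Fin 5 → Ω => ∏ i, f p i (x i)) (Measure.pi fun _ => μ) :=
    fun p => Integrable.fintype_prod fun i => hfi p i
  refine ⟨fun x => 𝔼 p, ∏ i, f p i (x i), integrable_expect hpi, ?_, fun k => ?_⟩
  · calc ∫ x, ‖𝔼 p, ∏ i, f p i (x i)‖ ∂(Measure.pi fun _ => μ)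
        ≤ ∫ x, 𝔼 p, ‖∏ i, f p i (x i)‖ ∂(Measure.pi fun _ => μ) :=
          integral_mono (integrable_expect hpi).norm (integrable_expect fun p => (hpi p).norm)
            fun x => norm_expect_le _
      _ = 𝔼 p, ∏ i, ∫ x, ‖f p i x‖ ∂μ := by
          rw [integral_expect fun p => (hpi p).norm]
          refine Finset.expect_congr rfl fun p _ => ?_
          simp_rw [norm_prod]
          exact integral_fintype_prod_eq_prod (𝕜 := ℝ) fun i x => ‖f p i x‖
      _ ≤ 𝔼 p : Fin 4 → ι → ℤˣ, ∫ x, ‖rieszKernel δ (z x) (∏ i, p i)‖ ∂μ := by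
          refine Finset.expect_le_expect fun p _ => ?_
          rw [Fin.prod_univ_castSucc, hfl]
          refine mul_le_of_le_one_left (integral_nonneg fun x => norm_nonneg _) ?_
          refine Finset.prod_le_one (fun i _ => integral_nonneg fun x => norm_nonneg _)
            fun i _ => ?_
          rw [hfc]
          exact hν _
      _ = ∫ x, 𝔼 p : Fin 4 → ι → ℤˣ, ‖rieszKernel δ (z x) (∏ i, p i)‖ ∂μ :=
          (integral_expect fun p => (hKi _).norm).symm
      _ ≤ ∫ _, 2 ∂μ := integral_mono (integrable_expect fun p => (hKi _).norm)
          (integrable_const _) fun x => expect_norm_rieszKernel_le hδ hδM (hzM x) (by norm_num)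
      _ = 2 := by simp
  · set h : (ι → ℤˣ) → ℂ := fun ε => ∫ x, ν ε x * φ k x ∂μ with hh
    have hhM : ∀ ε, ‖h ε‖ ≤ M := fun ε => by
      calc ‖h ε‖ ≤ ∫ x, ‖ν ε x * φ k x‖ ∂μ := norm_integral_le_integral_norm _
        _ ≤ ∫ x, ‖ν ε x‖ * M ∂μ := by
          refine integral_mono_of_nonneg (Filter.Eventually.of_forall fun x => norm_nonneg _)
            ((hνi ε).norm.mul_const M) (Filter.Eventually.of_forall fun x => ?_)
          simp only [norm_mul]
          exact mul_le_mul_of_nonneg_left (hφM k x) (norm_nonneg _)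
        _ ≤ 1 * M := by
          rw [integral_mul_const]
          exact mul_le_mul_of_nonneg_right (hν ε) hM0
        _ = M := one_mul M
    set b : Finset ι → ℂ := fun S => 𝔼 ε, h ε * (walsh S ε : ℂ) with hb
    have hbM : ∀ S, ‖b S‖ ≤ M := fun S => by
      refine (norm_expect_le _).trans (Finset.expect_le Finset.univ_nonempty fun ε _ => ?_)
      rw [norm_mul, Complex.norm_real, Real.norm_eq_abs, abs_walsh, mul_one]
      exact hhM ε
    have hbessel : ∑ S, ‖b S‖ ^ 2 ≤ M ^ 2 := (sum_norm_sq_expect_mul_walsh_le h).trans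
      (Finset.expect_le Finset.univ_nonempty fun ε _ =>
        pow_le_pow_left₀ (norm_nonneg _) (hhM ε) 2)
    -- Two factors are bounded by `M`; Bessel sums the other two over all `S`.
    have hb4 : ∑ S, ‖b S‖ ^ 4 ≤ M ^ 4 := by
      calc ∑ S, ‖b S‖ ^ 4 ≤ ∑ S, M ^ 2 * ‖b S‖ ^ 2 := by
            refine Finset.sum_le_sum fun S _ => ?_
            rw [show 4 = 2 + 2 from rfl, pow_add]
            exact mul_le_mul_of_nonneg_right (pow_le_pow_left₀ (norm_nonneg _) (hbM S) 2)
              (sq_nonneg _)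
        _ ≤ M ^ 2 * M ^ 2 := by
            rw [← Finset.mul_sum]; exact mul_le_mul_of_nonneg_left hbessel (sq_nonneg M)
        _ = M ^ 4 := by ring
    have hCφ : ∀ S, Integrable (fun x => rieszCoeff δ (z x) S * φ k x) μ := fun S =>
      (hCi S).mul_bdd (c := M) (hφ k).aestronglyMeasurable
        (Filter.Eventually.of_forall (hφM k))
    set c : Finset ι → ℂ := fun S => ∫ x, rieszCoeff δ (z x) S * φ k x ∂μ with hc
    have hKφ : ∀ η, ∫ x, rieszKernel δ (z x) η * φ k x ∂μ = ∑ S, c S * (walsh S η : ℂ) := by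
      intro η
      simp_rw [hKe, Finset.sum_mul, mul_right_comm _ ((walsh _ η : ℝ) : ℂ)]
      rw [integral_finsetSum _ fun S _ => (hCφ S).mul_const _]
      simp_rw [integral_mul_const, hc]
    have hgi : ∀ p i, Integrable (fun x => f p i x * φ k x) μ := fun p i =>
      (hfi p i).mul_bdd (c := M) (hφ k).aestronglyMeasurable
        (Filter.Eventually.of_forall (hφM k))
    have hmain : ∫ x, (𝔼 p, ∏ i, f p i (x i)) * tensorSystem 5 φ k x ∂(Measure.pi fun _ => μ) =
        ∑ S, c S * b S ^ 4 := by
      have e1 : ∀ x : Fin 5 → Ω, (𝔼 p, ∏ i, f p i (x i)) * tensorSystem 5 φ k x =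
          𝔼 p, ∏ i, (f p i (x i) * φ k (x i)) := fun x => by
        rw [Finset.expect_mul]
        exact Finset.expect_congr rfl fun p _ => by rw [tensorSystem, Finset.prod_mul_distrib]
      simp_rw [e1]
      rw [integral_expect fun p => Integrable.fintype_prod (f := fun i x => f p i x * φ k x)
        fun i => hgi p i]
      have e2 : ∀ p, ∫ x : Fin 5 → Ω, ∏ i, (f p i (x i) * φ k (x i)) ∂(Measure.pi fun _ => μ) =
          ∑ S, c S * ∏ i, (h (p i) * (walsh S (p i) : ℂ)) := fun p => by
        rw [integral_fintype_prod_eq_prod (𝕜 := ℂ) fun i x => f p i x * φ k x,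
          Fin.prod_univ_castSucc]
        simp_rw [hfl, hfc, hKφ, Finset.mul_sum, walsh_prod, Finset.prod_mul_distrib]
        refine Finset.sum_congr rfl fun S _ => ?_
        push_cast
        ring
      simp_rw [e2]
      rw [Finset.expect_sum_comm]
      simp_rw [← Finset.mul_expect]
      refine Finset.sum_congr rfl fun S _ => ?_
      rw [expect_prod_eq_pow 4 fun ε => h ε * (walsh S ε : ℂ)]
    have hbk : (𝔼 ε, (sgn ε k : ℂ) * ∫ x, ν ε x * φ k x ∂μ) = b {k} :=
      Finset.expect_congr rfl fun ε _ => by simp [walsh, mul_comm, hh]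
    have hc1 : ∀ j, c {j} = if j = k then δ / 2 * s k else 0 := fun j => by
      simp only [hc, rieszCoeff_singleton, hz, mul_assoc]
      rw [integral_const_mul, integral_const_mul, hφo]
      split_ifs with hjk
      · rw [hjk]; ring
      · simp
    -- The constant term must be removed exactly: it would be of order 1 in `δ`, and `b ∅` need not
    -- be small.
    have hc0 : c ∅ = 0 := by simp [hc, rieszCoeff]
    have hc2 : ∀ S, 2 ≤ S.card → ‖c S‖ ≤ (δ * M) ^ 2 * M := fun S hS => by
      have := norm_integral_le_of_norm_le_const (μ := μ) (C := (δ * M) ^ 2 * M)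
        (f := fun x => rieszCoeff δ (z x) S * φ k x) (Filter.Eventually.of_forall fun x => by
          rw [norm_mul]
          exact mul_le_mul (norm_rieszCoeff_le hδ hM0 hδM (hzM x) hS) (hφM k x) (norm_nonneg _)
            (by positivity))
      simpa using this
    rw [hmain, hbk, ← Finset.add_sum_erase _ _ (Finset.mem_univ {k}), hc1, if_pos rfl,
      add_sub_cancel_left]
    calc ‖∑ S ∈ Finset.univ.erase {k}, c S * b S ^ 4‖
        ≤ ∑ S ∈ Finset.univ.erase {k}, ‖c S * b S ^ 4‖ := norm_sum_le _ _
      _ ≤ ∑ S ∈ Finset.univ.erase {k}, (δ * M) ^ 2 * M * ‖b S‖ ^ 4 := by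
          refine Finset.sum_le_sum fun S hS => ?_
          rw [norm_mul, norm_pow]
          refine mul_le_mul_of_nonneg_right ?_ (by positivity)
          have hSk := Finset.ne_of_mem_erase hS
          rcases Nat.lt_or_ge S.card 2 with h2 | h2
          · have h0 : c S = 0 := by
              rcases Nat.lt_or_ge S.card 1 with h1 | h1
              · rw [Finset.card_eq_zero.1 (by omega : S.card = 0), hc0]
              · obtain ⟨j, rfl⟩ := Finset.card_eq_one.1 (by omega : S.card = 1)
                rw [hc1, if_neg fun hjk => hSk (by rw [hjk])]
            rw [h0, norm_zero]
            positivity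
          · exact hc2 S h2
      _ ≤ ∑ S, (δ * M) ^ 2 * M * ‖b S‖ ^ 4 :=
          Finset.sum_le_sum_of_subset_of_nonneg (Finset.erase_subset _ _)
            fun S _ _ => by positivity
      _ ≤ (δ * M) ^ 2 * M * M ^ 4 := by
          rw [← Finset.mul_sum]
          exact mul_le_mul_of_nonneg_left hb4 (by positivity)
      _ = δ ^ 2 * M ^ 7 := by ring

end TensorDensity

/-! ### Duality for finite families -/

section FiniteSidon

open scoped BigOperators

theorem measurable_tensorSystem {Ω ι : Type*} [MeasurableSpace Ω] {φ : ι → Ω → ℂ}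
    (hφ : ∀ j, Measurable (φ j)) (n : ℕ) (j : ι) : Measurable (tensorSystem n φ j) :=
  Finset.measurable_prod _ fun i _ => (hφ j).comp (measurable_pi_apply i)

theorem norm_tensorSystem_le {Ω ι : Type*} {φ : ι → Ω → ℂ} {M : ℝ}
    (hφM : ∀ j x, ‖φ j x‖ ≤ M) (n : ℕ) (j : ι) (x : Fin n → Ω) :
    ‖tensorSystem n φ j x‖ ≤ M ^ n := by
  rw [tensorSystem, norm_prod]
  exact (Finset.prod_le_prod (fun _ _ => norm_nonneg _) fun i _ => hφM j (x i)).trans (by simp)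

/-- The Sidon inequality for finite families ordered by decreasing coefficients. -/
theorem exists_finite_sidon {M C : ℝ} (hM : 1 ≤ M) (hC : 1 ≤ C) :
    ∃ γ : ℝ, 0 < γ ∧
      ∀ {Ω : Type*} [MeasurableSpace Ω] (μ : Measure Ω) [IsProbabilityMeasure μ] {N : ℕ}
        (φ : Fin N → Ω → ℂ) (a : Fin N → ℂ) (B : ℝ), (∀ j, Measurable (φ j)) →
        (∀ j x, ‖φ j x‖ ≤ M) →
        (∀ j k, ∫ x, starRingEnd ℂ (φ j x) * φ k x ∂μ = if j = k then 1 else 0) →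
        (∀ ζ : ℂ, ‖ζ‖ = 1 → SubgaussianTail μ (fun j x => (ζ * φ j x).re) C) →
        Antitone (fun j => ‖a j‖) →
        (∀ᵐ x ∂(Measure.pi fun _ : Fin 5 => μ), ‖∑ j, a j * tensorSystem 5 φ j x‖ ≤ B) →
        γ * ∑ j, ‖a j‖ ≤ B := by
  obtain ⟨c, hc, hc1, H⟩ := exists_random_density hM hC
  have hM0 : 0 < M := by linarith
  -- The main term is `δ c⁴/2` and the error `δ² M⁷` per unit of `∑ |a_j|`; this `δ` makes the error
  -- half of the main term. The factor 2 from the norm of `F` then leaves `γ = δ c⁴/8`.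
  set δ : ℝ := c ^ 4 / (4 * M ^ 7) with hδ
  have hδ0 : 0 < δ := by positivity
  have hδM7 : δ * M ^ 7 = c ^ 4 / 4 := by rw [hδ]; field_simp
  have hc4 : c ^ 4 ≤ 1 := pow_le_one₀ hc.le hc1
  have hδM : δ * M ≤ 1 := by
    have h1 : M ≤ M ^ 7 := le_self_pow₀ hM (by norm_num)
    have h2 := mul_le_mul_of_nonneg_left h1 hδ0.le
    linarith
  refine ⟨δ * c ^ 4 / 8, by positivity, ?_⟩
  intro Ω _ μ _ N φ a B hφ hφM hφo ht ha hB
  have hB0 : 0 ≤ B := by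
    obtain ⟨x, hx⟩ := hB.exists
    exact (norm_nonneg _).trans hx
  set S := ∑ j, ‖a j‖ with hS
  have hS0 : 0 ≤ S := Finset.sum_nonneg fun j _ => norm_nonneg _
  rcases hS0.eq_or_lt with h0 | hSpos
  · rw [← h0, mul_zero]; exact hB0
  have hφ1 : ∀ j, ∫ x, ‖φ j x‖ ^ 2 ∂μ = 1 := fun j => by
    have h1 := hφo j j
    simp_rw [Complex.conj_mul', if_true, ← Complex.ofReal_pow] at h1
    rw [integral_complex_ofReal] at h1
    exact_mod_cast h1
  obtain ⟨ν, hνi, hν, hνc⟩ := H μ φ (fun j => ‖a j‖ / S) hφ hφM hφ1 ht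
    (fun i j hij => div_le_div_of_nonneg_right (ha hij) hS0)
    (fun j => div_nonneg (norm_nonneg _) hS0)
    (by rw [← Finset.sum_div, ← hS, div_self hSpos.ne'])
  set b : Fin N → ℂ := fun j => 𝔼 ε, (sgn ε j : ℂ) * ∫ x, ν ε x * φ j x ∂μ with hb
  -- Phases making every `a_j s_j b_j ^ 4` nonnegative; division by zero gives phase 0, which is
  -- harmless.
  set s : Fin N → ℂ := fun j => starRingEnd ℂ (a j * b j ^ 4) / ‖a j * b j ^ 4‖ with hs
  have hs1 : ∀ j, ‖s j‖ ≤ 1 := fun j => by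
    simp only [hs]
    rw [norm_div, RCLike.norm_conj, Complex.norm_real, norm_norm]
    exact div_self_le_one _
  have hsb : ∀ j, a j * (s j * b j ^ 4) = ((‖a j‖ * ‖b j‖ ^ 4 : ℝ) : ℂ) := fun j => by
    have h1 : a j * (s j * b j ^ 4) = starRingEnd ℂ (a j * b j ^ 4) * (a j * b j ^ 4) /
        ‖a j * b j ^ 4‖ := by simp only [hs]; ring
    rw [h1, Complex.conj_mul', ← norm_pow, ← norm_mul]
    generalize ‖a j * b j ^ 4‖ = r
    by_cases h : r = 0
    · simp [h]
    · rw [sq, mul_div_assoc, div_self (by exact_mod_cast h), mul_one]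
  have hb4 : c ^ 4 * S ≤ ∑ j, ‖a j‖ * ‖b j‖ ^ 4 := by
    -- Jensen for the fourth power upgrades the weighted average bound on `|b_j|` to one on `|b_j| ^
    -- 4`.
    have h1 := Real.pow_arith_mean_le_arith_mean_pow Finset.univ (fun j => ‖a j‖ / S)
      (fun j => ‖b j‖) (fun j _ => div_nonneg (norm_nonneg _) hS0)
      (by rw [← Finset.sum_div, ← hS, div_self hSpos.ne']) (fun j _ => norm_nonneg _) 4
    have h2 : c ^ 4 ≤ ∑ j, ‖a j‖ / S * ‖b j‖ ^ 4 := (pow_le_pow_left₀ hc.le hνc 4).trans h1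
    simp_rw [div_mul_eq_mul_div] at h2
    rwa [← Finset.sum_div, le_div_iff₀ hSpos] at h2
  obtain ⟨F, hFi, hF2, hF⟩ := exists_interpolating_density hM hδ0.le hδM hφ hφM hφo hνi hν s hs1
  set π5 : Measure (Fin 5 → Ω) := Measure.pi fun _ => μ with hπ
  have hFΦ : ∀ k, Integrable (fun x => F x * tensorSystem 5 φ k x) π5 := fun k =>
    hFi.mul_bdd (c := M ^ 5) (measurable_tensorSystem hφ 5 k).aestronglyMeasurable
      (Filter.Eventually.of_forall (norm_tensorSystem_le hφM 5 k))
  have hup : ‖∑ k, a k * ∫ x, F x * tensorSystem 5 φ k x ∂π5‖ ≤ 2 * B := by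
    have h1 : ∑ k, a k * ∫ x, F x * tensorSystem 5 φ k x ∂π5 =
        ∫ x, F x * ∑ k, a k * tensorSystem 5 φ k x ∂π5 := by
      simp_rw [Finset.mul_sum, mul_left_comm (F _)]
      rw [integral_finsetSum _ fun k _ => (hFΦ k).const_mul _]
      simp_rw [integral_const_mul]
    rw [h1]
    calc ‖∫ x, F x * ∑ k, a k * tensorSystem 5 φ k x ∂π5‖
        ≤ ∫ x, ‖F x * ∑ k, a k * tensorSystem 5 φ k x‖ ∂π5 := norm_integral_le_integral_norm _
      _ ≤ ∫ x, ‖F x‖ * B ∂π5 := by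
          refine integral_mono_of_nonneg (Filter.Eventually.of_forall fun x => norm_nonneg _)
            (hFi.norm.mul_const B) ?_
          filter_upwards [hB] with x hx
          rw [norm_mul]
          exact mul_le_mul_of_nonneg_left hx (norm_nonneg _)
      _ = (∫ x, ‖F x‖ ∂π5) * B := integral_mul_const _ _
      _ ≤ 2 * B := mul_le_mul_of_nonneg_right hF2 hB0
  have hlow : δ / 2 * ∑ k, ‖a k‖ * ‖b k‖ ^ 4 - δ ^ 2 * M ^ 7 * S ≤
      (∑ k, a k * ∫ x, F x * tensorSystem 5 φ k x ∂π5).re := by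
    rw [Complex.re_sum, Finset.mul_sum, hS, Finset.mul_sum, ← Finset.sum_sub_distrib]
    refine Finset.sum_le_sum fun k _ => ?_
    set I := ∫ x, F x * tensorSystem 5 φ k x ∂π5 with hI
    have h1 : a k * I = ((δ / 2 * (‖a k‖ * ‖b k‖ ^ 4) : ℝ) : ℂ) +
        a k * (I - δ / 2 * s k * b k ^ 4) := by
      rw [Complex.ofReal_mul, ← hsb]; push_cast; ring
    have h2 : ‖a k * (I - δ / 2 * s k * b k ^ 4)‖ ≤ δ ^ 2 * M ^ 7 * ‖a k‖ := by
      rw [norm_mul, mul_comm]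
      exact mul_le_mul_of_nonneg_right (hF k) (norm_nonneg _)
    rw [h1, Complex.add_re, Complex.ofReal_re]
    have h3 := (abs_le.1 (Complex.abs_re_le_norm (a k * (I - δ / 2 * s k * b k ^ 4)))).1
    linarith
  have h1 := hlow.trans ((Complex.re_le_norm _).trans hup)
  have h2 : δ / 2 * (c ^ 4 * S) ≤ δ / 2 * ∑ k, ‖a k‖ * ‖b k‖ ^ 4 := by gcongr
  have h3 : δ ^ 2 * M ^ 7 * S = δ * (c ^ 4 / 4) * S := by rw [← hδM7]; ring
  rw [h3] at h1
  linarith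

end FiniteSidon

/-! ### From the Orlicz norm to tails -/

section PsiTwo

open Real

variable {Ω ι : Type*} [MeasurableSpace Ω] {μ : Measure Ω} {φ : ι → Ω → ℂ} {C : ℝ}

/-- Subgaussian tails from the `ψ₂` condition. -/
theorem PsiTwoCondition.measureReal_le [IsProbabilityMeasure μ] (h : PsiTwoCondition μ φ C)
    (hφ : ∀ j, AEStronglyMeasurable (φ j) μ) (s : Finset ι) (a : ι → ℂ) {A τ : ℝ} (hA : 0 < A)
    (hτ : 0 ≤ τ) (haA : ∑ j ∈ s, ‖a j‖ ^ 2 ≤ A) :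
    μ.real {x | τ ≤ ‖∑ j ∈ s, a j * φ j x‖} ≤
      2 * exp (-(τ ^ 2 / ((max C 0 + 1) ^ 2 * A))) := by
  set f : Ω → ℂ := fun x => ∑ j ∈ s, a j * φ j x with hf
  have hC0 : 0 ≤ max C 0 := le_max_right _ _
  -- Enlarging `C` to `max C 0 + 1` makes the inequality strict, so an admissible `t` exists below
  -- the bound without attaining the infimum.
  have hlt : psiTwoNorm μ f < ENNReal.ofReal ((max C 0 + 1) * √A) := by
    refine (h s a).trans_lt ?_
    have hsA : 0 < √A := sqrt_pos.2 hA
    rw [ENNReal.ofReal_lt_ofReal_iff (by positivity)]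
    have h1 : √(∑ j ∈ s, ‖a j‖ ^ 2) ≤ √A := sqrt_le_sqrt haA
    have h2 : C * √(∑ j ∈ s, ‖a j‖ ^ 2) ≤ max C 0 * √A :=
      mul_le_mul (le_max_left _ _) h1 (sqrt_nonneg _) hC0
    linarith
  simp only [psiTwoNorm, iInf_lt_iff] at hlt
  obtain ⟨t, ht0, hti, htlt⟩ := hlt
  have htT : t < (max C 0 + 1) * √A := by
    by_contra hc
    exact absurd (ENNReal.ofReal_le_ofReal (not_lt.1 hc)) (not_le.2 htlt)
  have hfm : AEMeasurable f μ :=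
    Finset.aemeasurable_fun_sum s fun j _ => (hφ j).aemeasurable.const_mul _
  have hmark := mul_meas_ge_le_lintegral₀ (μ := μ)
    (f := fun ω => ENNReal.ofReal (exp ((‖f ω‖ / t) ^ 2) - 1)) (by fun_prop)
    (ENNReal.ofReal (exp ((τ / t) ^ 2) - 1))
  have hsub : {x | τ ≤ ‖f x‖} ⊆ {x | ENNReal.ofReal (exp ((τ / t) ^ 2) - 1) ≤
      ENNReal.ofReal (exp ((‖f x‖ / t) ^ 2) - 1)} := by
    intro x hx
    have hx' : τ ≤ ‖f x‖ := hx
    refine ENNReal.ofReal_le_ofReal (sub_le_sub_right (exp_le_exp.2 ?_) 1)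
    gcongr
  have h1 : ENNReal.ofReal (exp ((τ / t) ^ 2) - 1) * μ {x | τ ≤ ‖f x‖} ≤ 1 :=
    (mul_le_mul_right (measure_mono hsub) _).trans (hmark.trans hti)
  have he : 0 ≤ exp ((τ / t) ^ 2) - 1 := by
    have := one_le_exp (sq_nonneg (τ / t)); linarith
  have h2 : (exp ((τ / t) ^ 2) - 1) * μ.real {x | τ ≤ ‖f x‖} ≤ 1 := by
    have := ENNReal.toReal_mono ENNReal.one_ne_top h1
    rwa [ENNReal.toReal_mul, ENNReal.toReal_ofReal he, ENNReal.toReal_one] at this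
  have h3 : μ.real {x | τ ≤ ‖f x‖} ≤ 1 := measureReal_le_one
  -- Markov controls `(e^{(τ/t)²} - 1)` times the probability by 1; adding that the probability is
  -- at most 1 explains the factor 2.
  have h4 : μ.real {x | τ ≤ ‖f x‖} ≤ 2 * exp (-(τ / t) ^ 2) := by
    rw [exp_neg, ← div_eq_mul_inv, le_div_iff₀ (exp_pos _)]
    linarith
  refine h4.trans ?_
  gcongr
  rw [div_pow]
  have h5 : t ^ 2 ≤ (max C 0 + 1) ^ 2 * A := by
    rw [← sq_sqrt hA.le, ← mul_pow]
    exact pow_le_pow_left₀ ht0.le htT.le 2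
  gcongr

end PsiTwo

/-! ### Tensor systems, good versions and passage to infinite families -/

section Final

open Real

variable {Ω ι : Type*} [MeasurableSpace Ω] {μ : Measure Ω} {φ : ι → Ω → ℂ} {M C : ℝ}

theorem tensorSystem_ae_eq [IsProbabilityMeasure μ] {ψ : ι → Ω → ℂ} {j : ι} (h : φ j =ᵐ[μ] ψ j)
    (n : ℕ) : tensorSystem n φ j =ᵐ[Measure.pi fun _ : Fin n => μ] tensorSystem n ψ j := by
  have h1 : ∀ i : Fin n, ∀ᵐ x ∂(Measure.pi fun _ : Fin n => μ), φ j (x i) = ψ j (x i) :=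
    fun i => (measurePreserving_eval (fun _ : Fin n => μ) i).quasiMeasurePreserving.ae h
  filter_upwards [ae_all_iff.2 h1] with x hx
  exact Finset.prod_congr rfl fun i _ => hx i

/-- A uniformly bounded system agrees almost everywhere with a pointwise bounded one. -/
theorem exists_measurable_bounded_version (hφ : ∀ j, AEStronglyMeasurable (φ j) μ)
    (hφM : UniformlyBoundedBy μ φ M) (hM : 0 ≤ M) :
    ∃ ψ : ι → Ω → ℂ, (∀ j, Measurable (ψ j)) ∧ (∀ j x, ‖ψ j x‖ ≤ M) ∧ ∀ j, φ j =ᵐ[μ] ψ j := by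
  refine ⟨fun j => {x | ‖(hφ j).mk _ x‖ ≤ M}.indicator ((hφ j).mk _), fun j => ?_, fun j x => ?_,
    fun j => ?_⟩
  · have hm : Measurable ((hφ j).mk _) := (hφ j).stronglyMeasurable_mk.measurable
    exact hm.indicator (measurableSet_le hm.norm measurable_const)
  · simp only
    by_cases h : x ∈ {x | ‖(hφ j).mk _ x‖ ≤ M}
    · rw [Set.indicator_of_mem h]; exact h
    · rw [Set.indicator_of_notMem h, norm_zero]; exact hM
  · have h1 : ∀ᵐ x ∂μ, ‖φ j x‖ₑ ≤ ENNReal.ofReal M := by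
      have h2 := hφM j
      rw [eLpNorm_exponent_top] at h2
      filter_upwards [ae_le_eLpNormEssSup (f := φ j) (μ := μ)] with x hx using hx.trans h2
    filter_upwards [(hφ j).ae_eq_mk, h1] with x hx hxM
    have h3 : x ∈ {x | ‖(hφ j).mk _ x‖ ≤ M} := by
      rw [Set.mem_ofPred_eq, ← hx]
      rwa [← ofReal_norm, ENNReal.ofReal_le_ofReal_iff hM] at hxM
    rw [Set.indicator_of_mem h3, hx]

theorem IsOrthonormalSystem.integral_eq [DecidableEq ι] (h : IsOrthonormalSystem μ φ) (j k : ι) :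
    ∫ x, starRingEnd ℂ (φ j x) * φ k x ∂μ = if j = k then 1 else 0 := by
  obtain ⟨hL, ho⟩ := h
  rw [← orthonormal_iff_ite.1 ho j k, L2.inner_def]
  refine integral_congr_ae ?_
  filter_upwards [(hL j).coeFn_toLp, (hL k).coeFn_toLp] with x hj hk
  rw [hj, hk, RCLike.inner_apply, mul_comm]

theorem isOrthonormalSystem_of_integral_eq [DecidableEq ι] (hL : ∀ j, MemLp (φ j) 2 μ)
    (h : ∀ j k, ∫ x, starRingEnd ℂ (φ j x) * φ k x ∂μ = if j = k then 1 else 0) :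
    IsOrthonormalSystem μ φ := by
  refine ⟨hL, orthonormal_iff_ite.2 fun j k => ?_⟩
  rw [← h j k, L2.inner_def]
  refine integral_congr_ae ?_
  filter_upwards [(hL j).coeFn_toLp, (hL k).coeFn_toLp] with x hj hk
  rw [hj, hk, RCLike.inner_apply, mul_comm]

theorem IsOrthonormalSystem.tensorSystem [IsProbabilityMeasure μ] (h : IsOrthonormalSystem μ φ)
    (hφM : UniformlyBoundedBy μ φ M) {n : ℕ} (hn : n ≠ 0) :
    IsOrthonormalSystem (Measure.pi fun _ : Fin n => μ) (tensorSystem n φ) := by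
  classical
  obtain ⟨ψ, hψ, hψM, hφψ⟩ := exists_measurable_bounded_version (M := max M 0)
    (fun j => (h.1 j).1)
    (fun j => (hφM j).trans (ENNReal.ofReal_le_ofReal (le_max_left _ _))) (le_max_right _ _)
  have hae := fun j => tensorSystem_ae_eq (hφψ j) n
  refine isOrthonormalSystem_of_integral_eq (fun j => ?_) fun j k => ?_
  · refine (memLp_congr_ae (hae j)).2 (MemLp.of_bound
      (measurable_tensorSystem hψ n j).aestronglyMeasurable _
      (Filter.Eventually.of_forall (norm_tensorSystem_le hψM n j)))
  · have h1 : ∫ x, starRingEnd ℂ (_root_.tensorSystem n φ j x) * _root_.tensorSystem n φ k x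
          ∂(Measure.pi fun _ : Fin n => μ) =
        ∫ x, ∏ i, (starRingEnd ℂ (φ j (x i)) * φ k (x i)) ∂(Measure.pi fun _ : Fin n => μ) := by
      refine integral_congr_ae (Filter.Eventually.of_forall fun x => ?_)
      simp only [_root_.tensorSystem, map_prod, Finset.prod_mul_distrib]
    rw [h1, integral_fintype_prod_eq_prod (𝕜 := ℂ) fun (_ : Fin n) x =>
      starRingEnd ℂ (φ j x) * φ k x, h.integral_eq]
    simp [hn]

theorem UniformlyBoundedBy.tensorSystem [IsProbabilityMeasure μ]
    (hφM : UniformlyBoundedBy μ φ M) {n : ℕ} (hn : n ≠ 0) :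
    UniformlyBoundedBy (Measure.pi fun _ : Fin n => μ) (tensorSystem n φ) (M ^ n) := by
  intro j
  rw [eLpNorm_exponent_top]
  have h1 : ∀ᵐ x ∂μ, ‖φ j x‖ₑ ≤ ENNReal.ofReal M := by
    have h2 := hφM j
    rw [eLpNorm_exponent_top] at h2
    filter_upwards [ae_le_eLpNormEssSup (f := φ j) (μ := μ)] with x hx using hx.trans h2
  have h2 : ∀ i : Fin n, ∀ᵐ x ∂(Measure.pi fun _ : Fin n => μ),
      ‖φ j (x i)‖ₑ ≤ ENNReal.ofReal M := fun i =>
    (measurePreserving_eval (fun _ : Fin n => μ) i).quasiMeasurePreserving.ae h1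
  -- For negative `M` the truncation gives 0 on the left, as `n ≠ 0`, so no sign assumption is
  -- needed.
  have h3 : ENNReal.ofReal M ^ n ≤ ENNReal.ofReal (M ^ n) := by
    rcases le_total 0 M with h | h
    · rw [ENNReal.ofReal_pow h]
    · rw [ENNReal.ofReal_of_nonpos h, zero_pow hn]; exact zero_le
  refine (essSup_le_of_ae_le _ ?_ : eLpNormEssSup _ _ ≤ ENNReal.ofReal M ^ n).trans h3
  filter_upwards [ae_all_iff.2 h2] with x hx
  rw [_root_.tensorSystem, ← ofReal_norm, norm_prod,
    ENNReal.ofReal_prod_of_nonneg fun i _ => norm_nonneg _]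
  simp_rw [ofReal_norm]
  calc ∏ i, ‖φ j (x i)‖ₑ ≤ ∏ _i : Fin n, ENNReal.ofReal M :=
        Finset.prod_le_prod' fun i _ => hx i
    _ = _ := by simp

/-- A finite set can be enumerated with decreasing values of a given function. -/
theorem exists_antitone_enumeration (s : Finset ι) (f : ι → ℝ) :
    ∃ e : Fin s.card ↪ ι, Antitone (fun i => f (e i)) ∧ Finset.univ.map e = s := by
  set g : Fin s.card → ℝ := fun i => -f (s.equivFin.symm i) with hg
  refine ⟨((Tuple.sort g).trans s.equivFin.symm).toEmbedding.trans (Function.Embedding.subtype _),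
    fun i j hij => ?_, ?_⟩
  · have := Tuple.monotone_sort g hij
    simp only [hg, Function.comp_apply, neg_le_neg_iff] at this
    exact this
  · rw [← Finset.map_map, Finset.map_univ_equiv]
    exact Finset.attach_map_val

theorem PsiTwoCondition.subgaussianTail [IsProbabilityMeasure μ] (h : PsiTwoCondition μ φ C)
    (hφ : ∀ j, AEStronglyMeasurable (φ j) μ) {ψ : ι → Ω → ℂ} (hφψ : ∀ j, φ j =ᵐ[μ] ψ j) {N : ℕ}
    (e : Fin N ↪ ι) {ζ : ℂ} (hζ : ‖ζ‖ = 1) :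
    SubgaussianTail μ (fun i x => (ζ * ψ (e i) x).re) (max C 0 + 1) := by
  intro a A τ hA hτ haA
  set α : ι → ℂ := Function.extend e (fun i => (a i : ℂ)) 0 with hα
  have hαe : ∀ i, α (e i) = a i := fun i => e.injective.extend_apply _ _ i
  refine le_trans ?_ (h.measureReal_le hφ (Finset.univ.map e) α hA hτ ?_)
  · refine ENNReal.toReal_mono (measure_ne_top _ _) (measure_mono_ae ?_)
    filter_upwards [ae_all_iff.2 fun i => hφψ (e i)] with x hx hτx
    have hτx' : τ ≤ ∑ i, a i * (ζ * ψ (e i) x).re := hτx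
    change τ ≤ ‖∑ j ∈ Finset.univ.map e, α j * φ j x‖
    rw [Finset.sum_map]
    simp_rw [hαe, hx]
    refine hτx'.trans ?_
    have h1 : ∑ i, a i * (ζ * ψ (e i) x).re = (ζ * ∑ i, (a i : ℂ) * ψ (e i) x).re := by
      rw [Finset.mul_sum, Complex.re_sum]
      exact Finset.sum_congr rfl fun i _ => by rw [mul_left_comm, Complex.re_ofReal_mul]
    rw [h1]
    refine (Complex.re_le_norm _).trans ?_
    rw [norm_mul, hζ, one_mul]
  · rw [Finset.sum_map]
    simp_rw [hαe, Complex.norm_real, Real.norm_eq_abs, sq_abs]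
    exact haA

/-- Five-fold tensor powers of bounded orthonormal `ψ₂` systems are Sidon. -/
theorem exists_sidonWith (M C : ℝ) :
    ∃ γ : ℝ, 0 < γ ∧ ∀ (Ω : Type u) [MeasurableSpace Ω] (μ : Measure Ω) [IsProbabilityMeasure μ]
      (ι : Type v) (φ : ι → Ω → ℂ), IsOrthonormalSystem μ φ → UniformlyBoundedBy μ φ M →
      PsiTwoCondition μ φ C → SidonWith (Measure.pi fun _ : Fin 5 => μ) (tensorSystem 5 φ) γ := by
  obtain ⟨γ, hγ, H⟩ := exists_finite_sidon (le_max_right M 1)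
    (le_add_of_nonneg_left (le_max_right C 0) : (1 : ℝ) ≤ max C 0 + 1)
  refine ⟨γ, hγ, ?_⟩
  intro Ω _ μ _ ι φ ho hφM hψ₂ a ha
  classical
  have hM0 : 0 ≤ max M 1 := zero_le_one.trans (le_max_right _ _)
  have hφ : ∀ j, AEStronglyMeasurable (φ j) μ := fun j => (ho.1 j).1
  obtain ⟨ψ, hψ, hψM, hφψ⟩ := exists_measurable_bounded_version (M := max M 1) hφ
    (fun j => (hφM j).trans (ENNReal.ofReal_le_ofReal (le_max_left _ _))) hM0
  set ν : Measure (Fin 5 → Ω) := Measure.pi fun _ : Fin 5 => μ with hν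
  set K : ℝ := max M 1 ^ 5 with hK
  set T : ℝ := ∑' j, ‖a j‖ with hT
  rcases eq_or_ne (eLpNorm (fun ω => ∑' j, a j * tensorSystem 5 φ j ω) ∞ ν) ∞ with htop | htop
  · rw [htop]; exact le_top
  set B : ℝ := (eLpNorm (fun ω => ∑' j, a j * tensorSystem 5 φ j ω) ∞ ν).toReal with hB
  rw [← ENNReal.ofReal_toReal htop, ← hB]
  refine ENNReal.ofReal_le_ofReal ?_
  have hBae : ∀ᵐ x ∂ν, ‖∑' j, a j * tensorSystem 5 φ j x‖ ≤ B := by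
    filter_upwards [ae_le_eLpNormEssSup (f := fun ω => ∑' j, a j * tensorSystem 5 φ j ω) (μ := ν)]
      with x hx
    rw [← eLpNorm_exponent_top] at hx
    rw [hB, ← toReal_enorm]
    exact ENNReal.toReal_mono htop hx
  -- The index set may be uncountable; only the countable support of `a` matters, so the exceptional
  -- null sets can be united.
  have hsupp : (Function.support a).Countable := by
    have := ha.countable_support
    simpa [Function.support] using this
  have hae : ∀ᵐ x ∂ν, ∀ j, a j * tensorSystem 5 φ j x = a j * tensorSystem 5 ψ j x := by
    have h1 : ∀ᵐ x ∂ν, ∀ j ∈ Function.support a, tensorSystem 5 φ j x = tensorSystem 5 ψ j x :=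
      (ae_ball_iff hsupp).2 fun j _ => tensorSystem_ae_eq (hφψ j) 5
    filter_upwards [h1] with x hx j
    by_cases hj : a j = 0
    · simp [hj]
    · rw [hx j hj]
  have hterm : ∀ j x, ‖a j * tensorSystem 5 ψ j x‖ ≤ ‖a j‖ * K := fun j x => by
    rw [norm_mul]
    exact mul_le_mul_of_nonneg_left (norm_tensorSystem_le hψM 5 j x) (norm_nonneg _)
  have hsn : ∀ x, Summable fun j => ‖a j * tensorSystem 5 ψ j x‖ := fun x =>
    Summable.of_nonneg_of_le (fun _ => norm_nonneg _) (fun j => hterm j x) (ha.mul_right K)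
  -- Apply the finite inequality to `s` in decreasing order of `|a_j|`; the omitted terms cost at
  -- most `K` times the tail of `∑ |a_j|`, which vanishes along the finite sets.
  have hfin : ∀ s : Finset ι, γ * ∑ j ∈ s, ‖a j‖ ≤ B + K * (T - ∑ j ∈ s, ‖a j‖) := by
    intro s
    obtain ⟨e, he, hes⟩ := exists_antitone_enumeration s fun j => ‖a j‖
    have h1 := H μ (fun i => ψ (e i)) (fun i => a (e i)) (B + K * (T - ∑ j ∈ s, ‖a j‖))
      (fun i => hψ (e i)) (fun i => hψM (e i)) (fun i k => by
        have h2 : ∫ x, starRingEnd ℂ (ψ (e i) x) * ψ (e k) x ∂μ =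
            ∫ x, starRingEnd ℂ (φ (e i) x) * φ (e k) x ∂μ := by
          refine integral_congr_ae ?_
          filter_upwards [hφψ (e i), hφψ (e k)] with x hi hk
          rw [hi, hk]
        rw [h2, ho.integral_eq]
        simp)
      (fun ζ hζ => hψ₂.subgaussianTail hφ hφψ e hζ) he (by
        filter_upwards [hBae, hae] with x hx hx'
        have h2 : ∑ i, a (e i) * tensorSystem 5 (fun i => ψ (e i)) i x =
            ∑ j ∈ s, a j * tensorSystem 5 ψ j x := by
          conv_rhs => rw [← hes, Finset.sum_map]
          rfl
        have h3 := (hsn x).of_norm.sum_add_tsum_subtype_compl s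
        have h4 := ha.sum_add_tsum_subtype_compl s
        simp_rw [hx'] at hx
        have h5 : ‖∑' j : {j // j ∉ s}, a j * tensorSystem 5 ψ j x‖ ≤
            K * (T - ∑ j ∈ s, ‖a j‖) := by
          have h6 : T - ∑ j ∈ s, ‖a j‖ = ∑' j : {j // j ∉ s}, ‖a j‖ := by
            rw [hT]; linarith
          rw [h6, mul_comm, ← tsum_mul_right]
          exact tsum_of_norm_bounded
            ((ha.subtype fun j => j ∉ s).mul_right K).hasSum fun j => hterm j x
        rw [h2, eq_sub_of_add_eq h3]
        exact (norm_sub_le _ _).trans (add_le_add hx h5))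
    have h2 : ∑ i, ‖a (e i)‖ = ∑ j ∈ s, ‖a j‖ := by
      conv_rhs => rw [← hes, Finset.sum_map]
    rwa [h2] at h1
  have hlim : Filter.Tendsto (fun s : Finset ι => ∑ j ∈ s, ‖a j‖) Filter.atTop (nhds T) :=
    ha.hasSum
  have h1 := hlim.const_mul γ
  have h2 : Filter.Tendsto (fun s : Finset ι => B + K * (T - ∑ j ∈ s, ‖a j‖)) Filter.atTop
      (nhds (B + K * (T - T))) := ((tendsto_const_nhds.sub hlim).const_mul K).const_add B
  have h3 := le_of_tendsto_of_tendsto' h1 h2 hfin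
  simpa using h3

end Final

theorem mainTheorem1 (M C : ℝ) :
    ∃ γ : ℝ, 0 < γ ∧
      ∀ (Ω : Type u) [MeasurableSpace Ω] (μ : Measure Ω) [IsProbabilityMeasure μ]
        (ι : Type v) (φ : ι → Ω → ℂ),
        IsOrthonormalSystem μ φ → UniformlyBoundedBy μ φ M → PsiTwoCondition μ φ C →
          IsOrthonormalSystem (Measure.pi fun _ : Fin 5 => μ) (tensorSystem 5 φ) ∧
          UniformlyBoundedBy (Measure.pi fun _ : Fin 5 => μ) (tensorSystem 5 φ) (M ^ 5) ∧
          SidonWith (Measure.pi fun _ : Fin 5 => μ) (tensorSystem 5 φ) γ := by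
  obtain ⟨γ, hγ, H⟩ := exists_sidonWith.{u, v} M C
  exact ⟨γ, hγ, fun Ω _ μ _ ι φ ho hφM hψ => ⟨ho.tensorSystem hφM (by norm_num),
    hφM.tensorSystem (by norm_num), H Ω μ ι φ ho hφM hψ⟩⟩
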